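/- Let $R=\begin{pmatrix} r_{11}&r_{12}&r_{13}\\0&r_{22}&r_{23}\\0&0&1\end{pmatrix}$ have nonnegative entries and all row sums equal to one, with $0<r_{22}<r_{11}$ and $r_{12}>0$. Consider the three-colour urn with replacement matrix $R$: the initial composition $C_0=(C_{01},C_{02},C_{03})$ is a non-random row vector with strictly positive entries whose sum is $1$; at trial $n\ge 1$, given the previous draws, a ball of colour $i$ is drawn with probability $C_{n-1,i}/n$, and then the $i$-th row of $R$ is added to $C_{n-1}$ to give $C_n$. Let $\xi_2=(r_{12},\,r_{22}-r_{11},\,0)'$. Then there is a nonnegative nondegenerate (that is, not almost surely constant) random variable $V_1$ such that $C_{n1}/n^{r_{11}}\to V_1$ almost surely and in $L^2$, and the following hold, where $N(0,S)$ for a random variable $S\ge 0$ denotes the variance mixture of normal laws, i.e. the law of $\sqrt S\,Z$ with $Z$ standard normal and independent of $S$. (i) If $r_{22}<r_{11}/2$, then $$\frac{C_n\xi_2}{\sqrt{n^{r_{11}}}}\Rightarrow N\Bigl(0,\ \frac{r_{12}r_{22}^2(r_{12}+r_{11}-r_{22})}{r_{11}-2r_{22}}\,V_1\Bigr).$$ (ii)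 If $r_{22}=r_{11}/2$, then $$\frac{C_n\xi_2}{\sqrt{n^{r_{11}}\log n}}\Rightarrow N\bigl(0,\ r_{12}r_{22}^2(r_{12}+r_{11}-r_{22})\,V_1\bigr).$$ (iii) If $r_{22}>r_{11}/2$, then $C_n\xi_2/n^{r_{22}}$ converges almost surely and in $L^2$ to a nondegenerate random variable. -/

import Mathlib

open MeasureTheory ProbabilityTheory Filter Topology
open scoped Matrix

noncomputable section

namespace Urn

variable {Ω ι : Type*}

/-- The composition of an urn with initial composition `c₀` and replacement matrix `R` when the
colour of the ball drawn at trial `n + 1` is `I n`: a draw of colour `i` adds row `i` of `R`. -/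
def count (R : Matrix ι ι ℝ) (c₀ : ι → ℝ) (I : ℕ → Ω → ι) : ℕ → Ω → ι → ℝ
  | 0, _ => c₀
  | n + 1, ω => count R c₀ I n ω + R (I n ω)

/-- The σ-algebra generated by the first `n` draws `I 0, …, I (n - 1)`. -/
abbrev history [MeasurableSpace ι] (I : ℕ → Ω → ι) (n : ℕ) : MeasurableSpace Ω :=
  ⨆ k ∈ Finset.range n, MeasurableSpace.comap (I k) inferInstance

/-- `I` is the sequence of colours drawn from a balanced urn with row sums one and total initial
content one (so that the urn contains `n + 1` balls in total after `n` trials): given the first `n`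
draws, the next ball drawn has colour `i` with probability `count n i / (n + 1)`. -/
structure IsDrawSequence [MeasurableSpace ι] [MeasurableSpace Ω] (μ : Measure Ω)
    (R : Matrix ι ι ℝ) (c₀ : ι → ℝ) (I : ℕ → Ω → ι) : Prop where
  measurable_draw : ∀ n, Measurable (I n)
  condProb_draw : ∀ n i,
    μ[(I n ⁻¹' {i}).indicator (fun _ => (1 : ℝ)) | history I n]
      =ᵐ[μ] fun ω => count R c₀ I n ω i / ((n : ℝ) + 1)

/-- A random variable is nondegenerate if it is not almost surely equal to a constant. -/
def Nondegenerate [MeasurableSpace Ω] (μ : Measure Ω) (Y : Ω → ℝ) : Prop :=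
  ∀ c : ℝ, ¬ Y =ᵐ[μ] fun _ => c

/-- Convergence of `X n` to the square integrable `Y`, almost surely and in `L²`. -/
def TendstoAEAndL2 [MeasurableSpace Ω] (μ : Measure Ω) (X : ℕ → Ω → ℝ) (Y : Ω → ℝ) : Prop :=
  (∀ᵐ ω ∂μ, Tendsto (fun n => X n ω) atTop (𝓝 (Y ω))) ∧
  (∀ n, MemLp (X n) 2 μ) ∧ MemLp Y 2 μ ∧
  Tendsto (fun n => eLpNorm (X n - Y) 2 μ) atTop (𝓝 0)

/-- `X n` converges in distribution to the variance mixture of normal laws `N(0, S)` with random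
variance `S ≥ 0`, that is, to the law of `√S * Z`, where `Z` is standard normal and independent
of `S`. The limit variable lives on the product of the given space with `(ℝ, N(0, 1))`. -/
def TendstoNormalMixture [MeasurableSpace Ω] (μ : Measure Ω) [IsProbabilityMeasure μ]
    (X : ℕ → Ω → ℝ) (S : Ω → ℝ) : Prop :=
  TendstoInDistribution X atTop (fun p : Ω × ℝ => √(S p.1) * p.2)
    (fun _ => μ) (μ.prod (gaussianReal 0 1))

end Urn

end

/-! The columns `e = (1, 0, 0)'` and `ξ₂` are right eigenvectors of `R` with eigenvalues `a = r11`
and `b = r22`. For any right eigenvector `u` with eigenvalue `r`, the ratio of `C_n u` to `growth r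
n = ∏ (1 + r / (j + 1))`, which is asymptotic to `n ^ r / Γ(r + 1)`, is a martingale. Its increments
have conditional variance `(r / growth r (n + 1))²` times the variance of `u` under the law of the
next draw.

What closes the system is the entrywise identity `ξ₂² = p e - q ξ₂`, with `p = r12 (r12 + r11 -
r22)` and `q = r11 - r22`. Let `M` and `N` be the martingales along `e` and `ξ₂`. The conditional
variance of an increment of `N` is then `p b² varWeight a b n * M n` plus an error controlled by
`C_n ξ₂ / (n + 1)`. The weights `varWeight a b n` have order `n ^ (a - 2b - 1)`. If `a < 2b` they
are summable and `N` converges almost surely and in `L²`. The same argument with `e² = e` always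
applies to `M`, and gives `V₁`. If `a ≥ 2b` the sum of the weights diverges, like a power or a
logarithm, and a central limit theorem with random variance proportional to the limit of `M` takes
over.

That theorem (`MixtureData.tendstoNormalMixture`) is proved with characteristic functions. With `V
k` the sum of the first `k` weights `v j` in the conditional variances `v j * M j`, the mean of `exp
(i t N_k / √V_n - t²/2 * M_k (V_n - V_k) / V_n)` is followed from `k = m` to `k = n`. In each step
the first order terms have conditional mean zero and the quadratic term in `N` is compensated. For
`n → ∞` the value at `k = m` tends to the mean of `exp (-t²/2 * M_m)`, and then `m → ∞`. -/

namespace Urn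

/-! ### Square integrable martingales: orthogonality, convergence, constant limits -/

section Martingale

variable {Ω : Type*} {m0 : MeasurableSpace Ω} {μ : Measure Ω}

/-- Pull-out property for a real variable against a bounded complex factor; the factor will be the
interpolating exponential. -/
theorem integral_smul_condExp [IsFiniteMeasure μ] {m : MeasurableSpace Ω} (hm : m ≤ m0)
    {Z : Ω → ℂ} {X : Ω → ℝ} {c : ℝ} (hZ : StronglyMeasurable[m] Z) (hZb : ∀ ω, ‖Z ω‖ ≤ c)
    (hX : Integrable X μ) :
    ∫ ω, X ω • Z ω ∂μ = ∫ ω, (μ[X | m]) ω • Z ω ∂μ := by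
  have hint : Integrable (fun ω => X ω • Z ω) μ :=
    hX.smul_bdd c (hZ.mono hm).aestronglyMeasurable (ae_of_all _ hZb)
  have hZi : Integrable Z μ :=
    Integrable.of_bound (hZ.mono hm).aestronglyMeasurable c (ae_of_all _ hZb)
  have h := condExp_bilin_of_stronglyMeasurable_right (ContinuousLinearMap.lsmul ℝ ℝ) (f := X)
    (g := Z) (m := m) (μ := μ) hZ (by simpa using hint) hX
  rw [← integral_condExp hm]
  exact integral_congr_ae (by simpa using h)

/-- The increments of a square integrable martingale are orthogonal to the past. -/
theorem integral_mul_martingale_sub [IsFiniteMeasure μ] {ℱ : Filtration ℕ m0} {f : ℕ → Ω → ℝ}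
    (hf : Martingale f ℱ μ) (hL2 : ∀ n, MemLp (f n) 2 μ) {g : Ω → ℝ} (n : ℕ)
    (hg : StronglyMeasurable[ℱ n] g) (hgL2 : MemLp g 2 μ) :
    ∫ ω, g ω * (f (n + 1) ω - f n ω) ∂μ = 0 := by
  have hd : MemLp (f (n + 1) - f n) 2 μ := (hL2 _).sub (hL2 _)
  have h := condExp_mul_of_stronglyMeasurable_left (μ := μ) hg (hgL2.integrable_mul hd)
    (hd.integrable (by norm_num))
  have h0 : μ[f (n + 1) - f n | ℱ n] =ᵐ[μ] 0 := by
    filter_upwards [condExp_sub (hf.integrable (n + 1)) (hf.integrable n) (ℱ n),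
      hf.2 n (n + 1) n.le_succ, hf.2 n n le_rfl] with ω h1 h2 h3
    rw [h1, Pi.sub_apply, h2, h3, sub_self, Pi.zero_apply]
  calc ∫ ω, g ω * (f (n + 1) ω - f n ω) ∂μ
      = ∫ ω, (μ[g * (f (n + 1) - f n) | ℱ n]) ω ∂μ := (integral_condExp (ℱ.le n)).symm
    _ = ∫ _, (0 : ℝ) ∂μ := by
        refine integral_congr_ae ?_
        filter_upwards [h, h0] with ω h1 h2
        rw [h1, Pi.mul_apply, h2, Pi.zero_apply, mul_zero]
    _ = 0 := by simp

/-- Pythagoras for square integrable martingales. -/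
theorem integral_sq_martingale_sub [IsFiniteMeasure μ] {ℱ : Filtration ℕ m0} {f : ℕ → Ω → ℝ}
    (hf : Martingale f ℱ μ) (hL2 : ∀ n, MemLp (f n) 2 μ) (m k : ℕ) :
    ∫ ω, (f (m + k) ω - f m ω) ^ 2 ∂μ
      = ∑ j ∈ Finset.range k, ∫ ω, (f (m + j + 1) ω - f (m + j) ω) ^ 2 ∂μ := by
  induction k with
  | zero => simp
  | succ k ih =>
    have hA : MemLp (f (m + k) - f m) 2 μ := (hL2 _).sub (hL2 _)
    have hB : MemLp (f (m + k + 1) - f (m + k)) 2 μ := (hL2 _).sub (hL2 _)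
    have h0 := integral_mul_martingale_sub hf hL2 (g := f (m + k) - f m) (m + k)
      ((hf.stronglyMeasurable _).sub ((hf.stronglyMeasurable m).mono (ℱ.mono (by omega)))) hA
    have hAB : Integrable (fun ω => (f (m + k) ω - f m ω) * (f (m + k + 1) ω - f (m + k) ω)) μ :=
      hA.integrable_mul hB
    have hA2 : Integrable (fun ω => (f (m + k) ω - f m ω) ^ 2) μ := hA.integrable_sq
    have hB2 : Integrable (fun ω => (f (m + k + 1) ω - f (m + k) ω) ^ 2) μ := hB.integrable_sq
    rw [Finset.sum_range_succ, ← ih]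
    calc ∫ ω, (f (m + (k + 1)) ω - f m ω) ^ 2 ∂μ
        = ∫ ω, ((f (m + k) ω - f m ω) ^ 2 + 2 * ((f (m + k) ω - f m ω) *
            (f (m + k + 1) ω - f (m + k) ω)) + (f (m + k + 1) ω - f (m + k) ω) ^ 2) ∂μ := by
          refine integral_congr_ae (ae_of_all _ fun ω => ?_)
          simp only [← add_assoc]
          ring
      _ = _ := by
          have hAA : Integrable (fun ω => (f (m + k) ω - f m ω) ^ 2 + 2 * ((f (m + k) ω - f m ω) *
            (f (m + k + 1) ω - f (m + k) ω))) μ := hA2.add (hAB.const_mul 2)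
          rw [integral_add hAA hB2, integral_add hA2 (hAB.const_mul 2), integral_const_mul]
          simp only [Pi.sub_apply] at h0
          rw [h0]
          ring

theorem integral_sq_martingale_sub_le [IsFiniteMeasure μ] {ℱ : Filtration ℕ m0} {f : ℕ → Ω → ℝ}
    (hf : Martingale f ℱ μ) (hL2 : ∀ n, MemLp (f n) 2 μ)
    (hs : Summable fun n => ∫ ω, (f (n + 1) ω - f n ω) ^ 2 ∂μ) (m n : ℕ) (hmn : m ≤ n) :
    ∫ ω, (f n ω - f m ω) ^ 2 ∂μ ≤ ∑' j, ∫ ω, (f (j + m + 1) ω - f (j + m) ω) ^ 2 ∂μ := by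
  obtain ⟨k, rfl⟩ := Nat.exists_eq_add_of_le hmn
  rw [integral_sq_martingale_sub hf hL2]
  have hs' := (summable_nat_add_iff m).2 hs
  refine le_trans (le_of_eq ?_) (hs'.sum_le_tsum (Finset.range k)
    fun j _ => integral_nonneg fun ω => sq_nonneg _)
  exact Finset.sum_congr rfl fun j _ => by simp only [add_comm m j]

theorem eLpNorm_two_eq_sqrt {g : Ω → ℝ} (hg : MemLp g 2 μ) :
    eLpNorm g 2 μ = ENNReal.ofReal (√(∫ ω, g ω ^ 2 ∂μ)) := by
  rw [hg.eLpNorm_eq_integral_rpow_norm (by norm_num) (by norm_num), Real.sqrt_eq_rpow]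
  simp

/-- A martingale whose increments have summable second moments converges almost surely and
in `L²`. -/
theorem tendstoAEAndL2_limitProcess [IsProbabilityMeasure μ] {ℱ : Filtration ℕ m0}
    {f : ℕ → Ω → ℝ} (hf : Martingale f ℱ μ) (hL2 : ∀ n, MemLp (f n) 2 μ)
    (hs : Summable fun n => ∫ ω, (f (n + 1) ω - f n ω) ^ 2 ∂μ) :
    TendstoAEAndL2 μ f (Filtration.limitProcess f ℱ μ) := by
  set T : ℕ → ℝ := fun m => ∑' j, ∫ ω, (f (j + m + 1) ω - f (j + m) ω) ^ 2 ∂μ with hT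
  have hT0 : Tendsto T atTop (𝓝 0) := by
    simpa [hT] using tendsto_sum_nat_add fun n => ∫ ω, (f (n + 1) ω - f n ω) ^ 2 ∂μ
  have hdist : ∀ m n, m ≤ n → eLpNorm (f n - f m) 2 μ ≤ ENNReal.ofReal (√(T m)) := by
    intro m n hmn
    rw [eLpNorm_two_eq_sqrt ((hL2 n).sub (hL2 m))]
    exact ENNReal.ofReal_le_ofReal (Real.sqrt_le_sqrt
      (integral_sq_martingale_sub_le hf hL2 hs m n hmn))
  have hbdd : ∀ n, eLpNorm (f n) 2 μ ≤ (eLpNorm (f 0) 2 μ + ENNReal.ofReal (√(T 0))).toNNReal := by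
    intro n
    rw [ENNReal.coe_toNNReal (ENNReal.add_ne_top.2 ⟨(hL2 0).eLpNorm_ne_top, ENNReal.ofReal_ne_top⟩)]
    calc eLpNorm (f n) 2 μ = eLpNorm (f 0 + (f n - f 0)) 2 μ := by rw [add_sub_cancel]
      _ ≤ _ := (eLpNorm_add_le (hL2 0).1 ((hL2 n).sub (hL2 0)).1 (by norm_num)).trans
        (add_le_add_right (hdist 0 n n.zero_le) _)
  have hlim : ∀ᵐ ω ∂μ, Tendsto (fun n => f n ω) atTop (𝓝 (Filtration.limitProcess f ℱ μ ω)) :=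
    hf.submartingale.ae_tendsto_limitProcess fun n =>
      (eLpNorm_le_eLpNorm_of_exponent_le (by norm_num) (hL2 n).1).trans (hbdd n)
  have hmem := hf.submartingale.memLp_limitProcess hbdd
  refine ⟨hlim, hL2, hmem, ?_⟩
  -- Fatou in `n` carries the tail bound on `f n - f m` over to the limit.
  have hle : ∀ m, eLpNorm (f m - Filtration.limitProcess f ℱ μ) 2 μ ≤ ENNReal.ofReal (√(T m)) := by
    intro m
    rw [← eLpNorm_neg, neg_sub]
    refine (Lp.eLpNorm_lim_le_liminf_eLpNorm (f := fun n => f n - f m)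
      (fun n => ((hL2 n).sub (hL2 m)).1) _ ?_).trans ?_
    · filter_upwards [hlim] with ω hω
      exact hω.sub_const _
    · refine liminf_le_of_frequently_le' (Eventually.frequently ?_)
      filter_upwards [eventually_ge_atTop m] with n hn using hdist m n hn
  refine tendsto_of_tendsto_of_tendsto_of_le_of_le tendsto_const_nhds ?_ (fun _ => zero_le) hle
  have := ENNReal.tendsto_ofReal (hT0.sqrt)
  simpa using this

/-- If the limit of an `L²` martingale is constant, so is the martingale. -/
theorem Martingale.ae_eq_const_of_limit [IsProbabilityMeasure μ] {ℱ : Filtration ℕ m0}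
    {f : ℕ → Ω → ℝ} {g : Ω → ℝ} (hf : Martingale f ℱ μ) (hg : TendstoAEAndL2 μ f g) {c : ℝ}
    (hc : g =ᵐ[μ] fun _ => c) (n : ℕ) : f n =ᵐ[μ] fun _ => c := by
  obtain ⟨-, hL2, hmem, ht⟩ := hg
  have h1 : Tendsto (fun n => eLpNorm (f n - g) 1 μ) atTop (𝓝 0) :=
    tendsto_of_tendsto_of_tendsto_of_le_of_le tendsto_const_nhds ht (fun _ => zero_le) fun n =>
      eLpNorm_le_eLpNorm_of_exponent_le (by norm_num) ((hL2 n).sub hmem).1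
  -- Convergence in `L¹` makes the martingale closed by its limit: `f n` is the conditional
  -- expectation of `g`.
  have h2 := hf.eq_condExp_of_tendsto_eLpNorm (hmem.integrable (by norm_num)) h1 n
  have h3 := condExp_congr_ae (m := ℱ n) hc
  rw [condExp_const (ℱ.le n)] at h3
  exact h2.trans h3

/-- Used to trade the normalization `growth r n` for `n ^ r`. In `L²`, split `a n X n - c Y` as `a n
(X n - Y) + (a n - c) Y`. -/
theorem TendstoAEAndL2.mul_const_seq [IsProbabilityMeasure μ] {X : ℕ → Ω → ℝ} {Y : Ω → ℝ}
    {a : ℕ → ℝ} {c : ℝ} (h : TendstoAEAndL2 μ X Y) (ha : Tendsto a atTop (𝓝 c)) :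
    TendstoAEAndL2 μ (fun n ω => a n * X n ω) (fun ω => c * Y ω) := by
  obtain ⟨hae, hL2, hmem, ht⟩ := h
  refine ⟨?_, fun n => (hL2 n).const_mul _, hmem.const_mul _, ?_⟩
  · filter_upwards [hae] with ω hω using ha.mul hω
  have hle : ∀ n, eLpNorm ((fun ω => a n * X n ω) - fun ω => c * Y ω) 2 μ
      ≤ ENNReal.ofReal |a n| * eLpNorm (X n - Y) 2 μ + ENNReal.ofReal |a n - c| * eLpNorm Y 2 μ := by
    intro n
    have he : ((fun ω => a n * X n ω) - fun ω => c * Y ω) = a n • (X n - Y) + (a n - c) • Y := by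
      ext ω; simp; ring
    rw [he]
    refine (eLpNorm_add_le (((hL2 n).sub hmem).const_smul _).1 (hmem.const_smul _).1
      (by norm_num)).trans ?_
    rw [eLpNorm_const_smul, eLpNorm_const_smul, Real.enorm_eq_ofReal_abs, Real.enorm_eq_ofReal_abs]
  refine tendsto_of_tendsto_of_tendsto_of_le_of_le tendsto_const_nhds ?_ (fun _ => zero_le) hle
  have h1 : Tendsto (fun n => ENNReal.ofReal |a n| * eLpNorm (X n - Y) 2 μ) atTop
      (𝓝 (ENNReal.ofReal |c| * 0)) :=
    ENNReal.Tendsto.mul (ENNReal.tendsto_ofReal ha.abs) (Or.inr (by simp)) ht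
      (Or.inr (by simp))
  have h2 : Tendsto (fun n => ENNReal.ofReal |a n - c| * eLpNorm Y 2 μ) atTop
      (𝓝 (ENNReal.ofReal |c - c| * eLpNorm Y 2 μ)) :=
    ENNReal.Tendsto.mul_const (ENNReal.tendsto_ofReal (ha.sub_const c).abs)
      (Or.inr hmem.eLpNorm_ne_top)
  simpa using h1.add h2

end Martingale

/-! ### Taylor estimates for one step of the interpolation -/

section MixtureCLT

/-- Second order Taylor expansion at `w = i x + q`. Since `q` plays the role of a variance, only
`-x² / 2` is kept from `w² / 2`; `x q` and `q²` join the cubic remainder. -/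
theorem norm_cexp_sub_le {B x q : ℝ} (hx : |x| ≤ B) (hq : |q| ≤ B) :
    ‖Complex.exp (x * Complex.I + q) - (1 + x * Complex.I + q - x ^ 2 / 2)‖
      ≤ (4 * (1 + B) * Real.exp (2 * B) + 1) * (|x| ^ 3 + q ^ 2 + |x| * |q|) := by
  have hB : 0 ≤ B := (abs_nonneg x).trans hx
  set w : ℂ := x * Complex.I + q with hw
  have hwn : ‖w‖ ≤ |x| + |q| := by
    refine (norm_add_le _ _).trans ?_
    simp
  have h1 := Complex.norm_exp_sub_sum_le_norm_mul_exp w 3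
  have hsum : ∑ m ∈ Finset.range 3, w ^ m / (m.factorial : ℂ) = 1 + w + w ^ 2 / 2 := by
    simp [Finset.sum_range_succ, Nat.factorial]
  rw [hsum] at h1
  have hw2 : (1 + w + w ^ 2 / 2) - (1 + x * Complex.I + q - x ^ 2 / 2)
      = x * q * Complex.I + q ^ 2 / 2 := by
    rw [hw]
    linear_combination (x : ℂ) ^ 2 / 2 * Complex.I_sq
  have h2 : ‖(x * q * Complex.I + q ^ 2 / 2 : ℂ)‖ ≤ |x| * |q| + q ^ 2 := by
    refine (norm_add_le _ _).trans ?_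
    simp only [norm_mul, Complex.norm_real, Complex.norm_I, norm_div, norm_pow, Real.norm_eq_abs,
      sq_abs, mul_one]
    have : ‖(2 : ℂ)‖ = 2 := by simp
    rw [this]
    nlinarith [sq_nonneg q]
  have hexp : Real.exp ‖w‖ ≤ Real.exp (2 * B) := Real.exp_le_exp.2 (by linarith)
  have h3 : ‖w‖ ^ 3 ≤ 4 * (1 + B) * (|x| ^ 3 + q ^ 2) := by
    have hx0 := abs_nonneg x
    have hq0 := abs_nonneg q
    calc ‖w‖ ^ 3 ≤ (|x| + |q|) ^ 3 := by gcongr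
      _ ≤ 4 * (|x| ^ 3 + |q| ^ 3) := by
        nlinarith [mul_nonneg (add_nonneg hx0 hq0) (sq_nonneg (|x| - |q|))]
      _ ≤ 4 * (|x| ^ 3 + B * q ^ 2) := by
        have : |q| ^ 3 ≤ B * q ^ 2 := by
          rw [pow_succ', sq_abs]
          gcongr
        linarith
      _ ≤ _ := by
        nlinarith [mul_nonneg hB (pow_nonneg hx0 3), sq_nonneg q]
  calc ‖Complex.exp w - (1 + x * Complex.I + q - x ^ 2 / 2)‖
      = ‖(Complex.exp w - (1 + w + w ^ 2 / 2)) + (x * q * Complex.I + q ^ 2 / 2)‖ := by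
        rw [← hw2]; congr 1; ring
    _ ≤ ‖w‖ ^ 3 * Real.exp ‖w‖ + (|x| * |q| + q ^ 2) := (norm_add_le _ _).trans (add_le_add h1 h2)
    _ ≤ 4 * (1 + B) * (|x| ^ 3 + q ^ 2) * Real.exp (2 * B) + (|x| * |q| + q ^ 2) := by gcongr
    _ ≤ _ := by
        have : 0 ≤ 4 * (1 + B) * Real.exp (2 * B) * (|x| * |q|) := by positivity
        have h4 : 0 ≤ |x| ^ 3 := by positivity
        nlinarith

/-- The constant in the third order remainder of the conditional characteristic function. -/
noncomputable def remConst (t A : ℝ) : ℝ :=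
  4 * (1 + (|t| * A + t ^ 2 * A)) * Real.exp (2 * (|t| * A + t ^ 2 * A)) + 1

theorem remConst_nonneg (t : ℝ) {A : ℝ} (hA : 0 ≤ A) : 0 ≤ remConst t A := by
  unfold remConst; positivity

/-- Here `q = U - y`, where `U` compensates the conditional variance and `y` comes from the
increment `p` of the mixing martingale. The cross term `|x| |y|` is not small by itself, so Young's
inequality with a free `δ` splits it into `δ x²`, whose sum stays bounded, and `δ⁻¹ y²`, whose sum
is a tail of a convergent series. -/
theorem norm_cexp_increment_sub_le {t A V τ δ d p u : ℝ} (hV : 1 ≤ V) (hτ0 : 0 ≤ τ) (hτ1 : τ ≤ 1)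
    (hδ : 0 < δ) (hd : |d| ≤ A) (hp : |p| ≤ A) (hu0 : 0 ≤ u) (huA : u ≤ A) :
    ‖Complex.exp ((t / √V * d : ℝ) * Complex.I + (t ^ 2 / 2 * (u / V) - t ^ 2 / 2 * τ * p : ℝ))
        - (1 + (t / √V * d : ℝ) * Complex.I + (t ^ 2 / 2 * (u / V) - t ^ 2 / 2 * τ * p : ℝ)
          - (t / √V * d : ℝ) ^ 2 / 2)‖
      ≤ remConst t A * ((|t| * A / √V + δ) * (t ^ 2 * d ^ 2 / V)
          + (t ^ 2 + |t|) * A / √V * (t ^ 2 / 2 * (u / V)) + (2 + δ⁻¹) * (t ^ 2 / 2) ^ 2 * p ^ 2) := by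
  have hV0 : 0 < V := by linarith
  have hA : 0 ≤ A := (abs_nonneg d).trans hd
  have hs1 : 1 ≤ √V := by rwa [Real.one_le_sqrt]
  have hs0 : 0 < √V := by linarith
  have hsV : √V ≤ V := by
    nlinarith [Real.sq_sqrt hV0.le]
  set x : ℝ := t / √V * d with hxdef
  set U : ℝ := t ^ 2 / 2 * (u / V) with hU
  set y : ℝ := t ^ 2 / 2 * τ * p with hy
  have hxabs : |x| ≤ |t| * A / √V := by
    rw [hxdef, abs_mul, abs_div, abs_of_pos hs0, div_mul_eq_mul_div]
    gcongr
  have hxB : |x| ≤ |t| * A := hxabs.trans (div_le_self (by positivity) hs1)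
  have hU0 : 0 ≤ U := by positivity
  have hUs : U ≤ t ^ 2 / 2 * A / √V := by
    rw [hU, mul_div_assoc]
    gcongr
  have hUB : U ≤ t ^ 2 / 2 * A := hUs.trans (div_le_self (by positivity) hs1)
  have hyp : |y| ≤ t ^ 2 / 2 * |p| := by
    rw [hy, abs_mul, abs_mul, abs_of_nonneg hτ0, abs_of_nonneg (by positivity : 0 ≤ t ^ 2 / 2)]
    gcongr
    nlinarith [sq_nonneg t]
  have hyB : |y| ≤ t ^ 2 / 2 * A := hyp.trans (by gcongr)
  have hq : |U - y| ≤ t ^ 2 * A := by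
    have := abs_sub U y
    rw [abs_of_nonneg hU0] at this
    linarith
  have hx2 : x ^ 2 = t ^ 2 * d ^ 2 / V := by
    rw [hxdef, mul_pow, div_pow, Real.sq_sqrt hV0.le]; ring
  have hy2 : y ^ 2 ≤ (t ^ 2 / 2) ^ 2 * p ^ 2 := by
    rw [← sq_abs y, ← sq_abs p, ← mul_pow]
    gcongr
  have ht2A : 0 ≤ t ^ 2 * A := by positivity
  -- This `B` dominates both `|x|` and `|U - y|` because `V ≥ 1`.
  refine (norm_cexp_sub_le (B := |t| * A + t ^ 2 * A) (hxB.trans (by linarith))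
    (hq.trans (by linarith [mul_nonneg (abs_nonneg t) hA]))).trans ?_
  refine mul_le_mul_of_nonneg_left ?_ (remConst_nonneg t hA)
  have e1 : |x| ^ 3 ≤ |t| * A / √V * x ^ 2 := by
    rw [pow_succ', sq_abs]; gcongr
  have e2 : (U - y) ^ 2 ≤ 2 * U ^ 2 + 2 * y ^ 2 := by nlinarith [sq_nonneg (U + y)]
  have e3 : |x| * |U - y| ≤ |x| * U + |x| * |y| := by
    have := abs_sub U y
    rw [abs_of_nonneg hU0] at this
    rw [← mul_add]; gcongr
  have e4 : |x| * |y| ≤ δ * x ^ 2 + δ⁻¹ * y ^ 2 := by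
    have h1 : 0 ≤ δ⁻¹ * (δ * |x| - |y|) ^ 2 := by positivity
    have h2 : δ⁻¹ * (δ * |x| - |y|) ^ 2 = δ * x ^ 2 - 2 * (|x| * |y|) + δ⁻¹ * y ^ 2 := by
      rw [← sq_abs x, ← sq_abs y]; field_simp; ring
    nlinarith [mul_nonneg (abs_nonneg x) (abs_nonneg y)]
  have e5 : U ^ 2 ≤ t ^ 2 / 2 * A / √V * U := by rw [sq]; gcongr
  have e6 : |x| * U ≤ |t| * A / √V * U := by gcongr
  have e7 : (t ^ 2 + |t|) * A / √V * U = 2 * (t ^ 2 / 2 * A / √V * U) + |t| * A / √V * U := by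
    ring
  have e8 : (2 + δ⁻¹) * y ^ 2 ≤ (2 + δ⁻¹) * ((t ^ 2 / 2) ^ 2 * p ^ 2) := by gcongr
  have e9 : (2 + δ⁻¹) * y ^ 2 = 2 * y ^ 2 + δ⁻¹ * y ^ 2 := add_mul _ _ _
  have e10 : (|t| * A / √V + δ) * x ^ 2 = |t| * A / √V * x ^ 2 + δ * x ^ 2 := add_mul _ _ _
  rw [← hx2, e7, e10, mul_assoc (2 + δ⁻¹)]
  linarith

variable {Ω : Type*} {m0 : MeasurableSpace Ω} {μ : Measure Ω} [IsProbabilityMeasure μ]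

/-- Against a factor `Z` known at the previous time, `D` and `P` integrate to zero, and the mean of
`-t² D² / (2V)` cancels that of `t² Q / (2V)` up to `err`. What remains is the Taylor remainder. -/
theorem norm_integral_mul_cexp_sub_one_le {m : MeasurableSpace Ω} (hm : m ≤ m0)
    {Z : Ω → ℂ} {D P Q err : Ω → ℝ} {t A V τ δ : ℝ} (hV : 1 ≤ V) (hτ0 : 0 ≤ τ) (hτ1 : τ ≤ 1)
    (hδ : 0 < δ) (hZ : StronglyMeasurable[m] Z) (hZ1 : ∀ ω, ‖Z ω‖ ≤ 1)
    (hDm : Measurable[m0] D) (hPm : Measurable[m0] P) (hQm : Measurable[m0] Q)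
    (hD : ∀ ω, |D ω| ≤ A) (hP : ∀ ω, |P ω| ≤ A) (hQ0 : ∀ ω, 0 ≤ Q ω) (hQ : ∀ ω, Q ω ≤ A)
    (hD0 : μ[D | m] =ᵐ[μ] 0) (hP0 : μ[P | m] =ᵐ[μ] 0) (herr : Integrable err μ)
    (hD2 : μ[fun ω => D ω ^ 2 | m] =ᵐ[μ] fun ω => Q ω + err ω) :
    ‖∫ ω, Z ω * (Complex.exp ((t / √V * D ω : ℝ) * Complex.I
        + (t ^ 2 / 2 * (Q ω / V) - t ^ 2 / 2 * τ * P ω : ℝ)) - 1) ∂μ‖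
      ≤ t ^ 2 / 2 / V * ∫ ω, |err ω| ∂μ
        + remConst t A * ((|t| * A / √V + δ) * (t ^ 2 / V * ∫ ω, D ω ^ 2 ∂μ)
          + (t ^ 2 + |t|) * A / √V * (t ^ 2 / 2 / V * ∫ ω, Q ω ∂μ)
          + (2 + δ⁻¹) * (t ^ 2 / 2) ^ 2 * ∫ ω, P ω ^ 2 ∂μ) := by
  have hV0 : 0 < V := by linarith
  have hDi : Integrable D μ := Integrable.of_bound hDm.aestronglyMeasurable A (ae_of_all _ hD)
  have hPi : Integrable P μ := Integrable.of_bound hPm.aestronglyMeasurable A (ae_of_all _ hP)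
  have hQi : Integrable Q μ := Integrable.of_bound hQm.aestronglyMeasurable A
    (ae_of_all _ fun ω => by rw [Real.norm_eq_abs, abs_of_nonneg (hQ0 ω)]; exact hQ ω)
  have hsq : ∀ {F : Ω → ℝ}, Measurable[m0] F → (∀ ω, |F ω| ≤ A) → Integrable (fun ω => F ω ^ 2) μ := by
    intro F hF hFA
    refine Integrable.of_bound (hF.pow_const 2).aestronglyMeasurable (A ^ 2) (ae_of_all _ fun ω => ?_)
    rw [norm_pow, Real.norm_eq_abs]
    exact pow_le_pow_left₀ (abs_nonneg _) (hFA ω) 2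
  have hD2i := hsq hDm hD
  have hP2i := hsq hPm hP
  have hZm := (hZ.mono hm).aestronglyMeasurable (μ := μ)
  have hsm : ∀ {X : Ω → ℝ}, Integrable X μ → Integrable (fun ω => X ω • Z ω) μ := fun hX =>
    hX.smul_bdd 1 hZm (ae_of_all _ hZ1)
  have i1 : ∫ ω, D ω • Z ω ∂μ = 0 := by
    rw [integral_smul_condExp hm hZ hZ1 hDi]
    rw [integral_congr_ae (g := fun _ => (0 : ℂ))]
    · simp
    · filter_upwards [hD0] with ω h; simp [h]
  have i2 : ∫ ω, P ω • Z ω ∂μ = 0 := by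
    rw [integral_smul_condExp hm hZ hZ1 hPi]
    rw [integral_congr_ae (g := fun _ => (0 : ℂ))]
    · simp
    · filter_upwards [hP0] with ω h; simp [h]
  have i3 : ∫ ω, (D ω ^ 2) • Z ω ∂μ = (∫ ω, Q ω • Z ω ∂μ) + ∫ ω, err ω • Z ω ∂μ := by
    rw [integral_smul_condExp hm hZ hZ1 hD2i, ← integral_add (hsm hQi) (hsm herr)]
    refine integral_congr_ae ?_
    filter_upwards [hD2] with ω h
    rw [h, add_smul]
  set E : Ω → ℂ := fun ω => Complex.exp ((t / √V * D ω : ℝ) * Complex.I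
        + (t ^ 2 / 2 * (Q ω / V) - t ^ 2 / 2 * τ * P ω : ℝ)) with hE
  set L : Ω → ℂ := fun ω => (t / √V * D ω : ℝ) * Complex.I
        + (t ^ 2 / 2 * (Q ω / V) - t ^ 2 / 2 * τ * P ω : ℝ) - (t / √V * D ω : ℝ) ^ 2 / 2 with hL
  set G : Ω → ℝ := fun ω => remConst t A * ((|t| * A / √V + δ) * (t ^ 2 * D ω ^ 2 / V)
          + (t ^ 2 + |t|) * A / √V * (t ^ 2 / 2 * (Q ω / V))
          + (2 + δ⁻¹) * (t ^ 2 / 2) ^ 2 * P ω ^ 2) with hG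
  have hbound : ∀ ω, ‖Z ω * (E ω - 1 - L ω)‖ ≤ G ω := by
    intro ω
    have h := norm_cexp_increment_sub_le (t := t) hV hτ0 hτ1 hδ (hD ω) (hP ω) (hQ0 ω) (hQ ω)
    rw [norm_mul]
    calc ‖Z ω‖ * ‖E ω - 1 - L ω‖ ≤ 1 * ‖E ω - 1 - L ω‖ := by gcongr; exact hZ1 ω
      _ = ‖E ω - 1 - L ω‖ := one_mul _
      _ ≤ _ := by
        refine le_trans (le_of_eq ?_) h
        simp only [hE, hL]
        congr 1
        ring
  have hGi : Integrable G μ := by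
    refine Integrable.const_mul ?_ _
    refine Integrable.add (Integrable.add ?_ ?_) ?_
    · exact ((hD2i.const_mul _).div_const _).const_mul _
    · exact ((hQi.div_const _).const_mul _).const_mul _
    · exact hP2i.const_mul _
  have hEm : Measurable[m0] E := by
    refine Complex.measurable_exp.comp ?_
    fun_prop
  have hLm : Measurable[m0] L := by
    simp only [hL]
    fun_prop
  have hRi : Integrable (fun ω => Z ω * (E ω - 1 - L ω)) μ :=
    hGi.mono' (hZm.mul ((hEm.sub_const 1).sub hLm).aestronglyMeasurable) (ae_of_all _ hbound)
  have hLeq : ∀ ω, Z ω * L ω = ((t / √V : ℝ) * Complex.I) * (D ω • Z ω)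
      + ((t ^ 2 / 2 / V : ℝ) : ℂ) * (Q ω • Z ω) - ((t ^ 2 / 2 * τ : ℝ) : ℂ) * (P ω • Z ω)
      - ((t ^ 2 / 2 / V : ℝ) : ℂ) * ((D ω ^ 2) • Z ω) := by
    intro ω
    have hs : ((√V : ℝ) : ℂ) ^ 2 = (V : ℂ) := by
      rw [← Complex.ofReal_pow, Real.sq_sqrt hV0.le]
    simp only [hL, Complex.real_smul]
    push_cast
    rw [mul_pow, div_pow, hs]
    ring
  have j1 := (hsm hDi).const_mul (((t / √V : ℝ) : ℂ) * Complex.I)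
  have j2 := (hsm hQi).const_mul ((t ^ 2 / 2 / V : ℝ) : ℂ)
  have j3 := (hsm hPi).const_mul ((t ^ 2 / 2 * τ : ℝ) : ℂ)
  have j4 := (hsm hD2i).const_mul ((t ^ 2 / 2 / V : ℝ) : ℂ)
  have hLi : Integrable (fun ω => Z ω * L ω) μ := by
    simp_rw [hLeq]
    exact ((j1.add j2).sub j3).sub j4
  -- After the cancellations only the error in the conditional variance survives in the integral of
  -- `Z * L`.
  have hLint : ∫ ω, Z ω * L ω ∂μ = -((t ^ 2 / 2 / V : ℝ) : ℂ) * ∫ ω, err ω • Z ω ∂μ := by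
    simp_rw [hLeq]
    have j12 : Integrable (fun ω => ((t / √V : ℝ) * Complex.I) * (D ω • Z ω)
      + ((t ^ 2 / 2 / V : ℝ) : ℂ) * (Q ω • Z ω)) μ := j1.add j2
    have j123 : Integrable (fun ω => ((t / √V : ℝ) * Complex.I) * (D ω • Z ω)
      + ((t ^ 2 / 2 / V : ℝ) : ℂ) * (Q ω • Z ω) - ((t ^ 2 / 2 * τ : ℝ) : ℂ) * (P ω • Z ω)) μ :=
      j12.sub j3
    rw [integral_sub j123 j4, integral_sub j12 j3, integral_add j1 j2, integral_const_mul,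
      integral_const_mul, integral_const_mul, integral_const_mul, i1, i2, i3]
    ring
  have hsplit : ∫ ω, Z ω * (E ω - 1) ∂μ
      = ∫ ω, Z ω * L ω ∂μ + ∫ ω, Z ω * (E ω - 1 - L ω) ∂μ := by
    rw [← integral_add hLi hRi]
    refine integral_congr_ae (ae_of_all _ fun ω => ?_)
    ring
  rw [hsplit]
  refine (norm_add_le _ _).trans (add_le_add ?_ ?_)
  · rw [hLint, norm_mul, norm_neg, Complex.norm_real, Real.norm_of_nonneg (by positivity)]
    refine mul_le_mul_of_nonneg_left ?_ (by positivity)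
    refine norm_integral_le_of_norm_le herr.abs (ae_of_all _ fun ω => ?_)
    rw [norm_smul, Real.norm_eq_abs]
    exact mul_le_of_le_one_right (abs_nonneg _) (hZ1 ω)
  · refine (norm_integral_le_of_norm_le hGi (ae_of_all _ hbound)).trans (le_of_eq ?_)
    simp only [hG]
    have k1 : Integrable (fun ω => (|t| * A / √V + δ) * (t ^ 2 * D ω ^ 2 / V)) μ :=
      ((hD2i.const_mul _).div_const _).const_mul _
    have k2 : Integrable (fun ω => (t ^ 2 + |t|) * A / √V * (t ^ 2 / 2 * (Q ω / V))) μ :=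
      ((hQi.div_const _).const_mul _).const_mul _
    have k3 : Integrable (fun ω => (2 + δ⁻¹) * (t ^ 2 / 2) ^ 2 * P ω ^ 2) μ := hP2i.const_mul _
    have k12 : Integrable (fun ω => (|t| * A / √V + δ) * (t ^ 2 * D ω ^ 2 / V) +
      (t ^ 2 + |t|) * A / √V * (t ^ 2 / 2 * (Q ω / V))) μ := k1.add k2
    rw [integral_const_mul, integral_add k12 k3, integral_add k1 k2]
    simp only [integral_const_mul, integral_div]
    ring

end MixtureCLT

/-! ### Martingale central limit theorem with random variance -/

section MixtureCLT

set_option linter.unusedSectionVars false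

variable {Ω : Type*} {m0 : MeasurableSpace Ω} {μ : Measure Ω} [IsProbabilityMeasure μ]

/-- Interpolation between `exp (i t Nₙ / √Vₙ)` and a Gaussian characteristic function with
random variance. -/
noncomputable def interp (t : ℝ) (M N : ℕ → Ω → ℝ) (V : ℕ → ℝ) (n k : ℕ) (ω : Ω) : ℂ :=
  Complex.exp ((t / √(V n) * N k ω : ℝ) * Complex.I
    + (-(t ^ 2 / 2 * (M k ω * ((V n - V k) / V n))) : ℝ))

/-- The real part of the exponent is nonpositive. The bound by one lets the interpolant serve as the
factor `Z`. -/
theorem norm_interp_le_one {t : ℝ} {M N : ℕ → Ω → ℝ} {V : ℕ → ℝ} {n k : ℕ} {ω : Ω}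
    (hM : 0 ≤ M k ω) (hV : 0 ≤ (V n - V k) / V n) : ‖interp t M N V n k ω‖ ≤ 1 := by
  rw [interp, Complex.norm_exp]
  simp only [Complex.add_re, Complex.mul_re, Complex.ofReal_re, Complex.I_re, mul_zero,
    Complex.ofReal_im, Complex.I_im, zero_mul, sub_zero, zero_add]
  rw [Real.exp_le_one_iff, neg_nonpos]
  positivity

/-- Summation by parts: from `k` to `k + 1`, the product `M_k (V_n - V_k)` loses `v_k M_k` and gains
`(M_{k+1} - M_k) (V_n - V_{k+1})`. -/
theorem interp_succ {t : ℝ} {M N : ℕ → Ω → ℝ} {V v : ℕ → ℝ} {n k : ℕ} {ω : Ω}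
    (hv : V (k + 1) = V k + v k) :
    interp t M N V n (k + 1) ω = interp t M N V n k ω *
      Complex.exp ((t / √(V n) * (N (k + 1) ω - N k ω) : ℝ) * Complex.I
        + (t ^ 2 / 2 * ((v k * M k ω) / V n)
          - t ^ 2 / 2 * ((V n - V (k + 1)) / V n) * (M (k + 1) ω - M k ω) : ℝ)) := by
  rw [interp, interp, ← Complex.exp_add, hv]
  congr 1
  push_cast
  ring

theorem martingale_integral_eq {ℱ : Filtration ℕ m0} {f : ℕ → Ω → ℝ} (hf : Martingale f ℱ μ)
    (n : ℕ) : ∫ ω, f n ω ∂μ = ∫ ω, f 0 ω ∂μ := by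
  rw [← integral_condExp (ℱ.le 0) (f := f n)]
  exact integral_congr_ae (hf.2 0 n n.zero_le)

theorem martingale_condExp_sub {ℱ : Filtration ℕ m0} {f : ℕ → Ω → ℝ} (hf : Martingale f ℱ μ)
    (n : ℕ) : μ[fun ω => f (n + 1) ω - f n ω | ℱ n] =ᵐ[μ] 0 := by
  filter_upwards [condExp_sub (hf.integrable (n + 1)) (hf.integrable n) (ℱ n),
    hf.2 n (n + 1) n.le_succ, hf.2 n n le_rfl] with ω h1 h2 h3
  have h1' : (μ[fun ω => f (n + 1) ω - f n ω | ℱ n]) ω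
      = ((μ[f (n + 1) | ℱ n]) - (μ[f n | ℱ n])) ω := h1
  rw [h1', Pi.sub_apply, h2, h3, sub_self, Pi.zero_apply]

/-- The data of the martingale central limit theorem with a mixing variance: the conditional
variances of the increments of `N` are `v n * M n` up to errors that are negligible in `L¹`,
where `M` is a nonnegative martingale with summable increments in `L²`. -/
structure MixtureData (μ : Measure Ω) (ℱ : Filtration ℕ m0) (M N : ℕ → Ω → ℝ) (v : ℕ → ℝ)
    (err : ℕ → Ω → ℝ) (A : ℝ) : Prop where
  martM : Martingale M ℱ μ
  martN : Martingale N ℱ μ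
  nonneg : ∀ n ω, 0 ≤ M n ω
  v_nonneg : ∀ n, 0 ≤ v n
  boundM : ∀ n ω, |M (n + 1) ω - M n ω| ≤ A
  boundN : ∀ n ω, |N (n + 1) ω - N n ω| ≤ A
  boundv : ∀ n ω, v n * M n ω ≤ A
  integrable_err : ∀ n, Integrable (err n) μ
  condVar : ∀ n, μ[fun ω => (N (n + 1) ω - N n ω) ^ 2 | ℱ n] =ᵐ[μ]
    fun ω => v n * M n ω + err n ω
  tendsto_sum : Tendsto (fun n => ∑ k ∈ Finset.range n, v k) atTop atTop
  tendsto_err : Tendsto (fun n => (∑ k ∈ Finset.range n, ∫ ω, |err k ω| ∂μ) /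
    ∑ k ∈ Finset.range n, v k) atTop (𝓝 0)
  summable : Summable fun n => ∫ ω, (M (n + 1) ω - M n ω) ^ 2 ∂μ

variable {ℱ : Filtration ℕ m0} {M N : ℕ → Ω → ℝ} {v : ℕ → ℝ} {err : ℕ → Ω → ℝ} {A : ℝ}

theorem MixtureData.measurable_martM (h : MixtureData μ ℱ M N v err A) (n : ℕ) :
    Measurable (M n) := ((h.martM.stronglyMeasurable n).mono (ℱ.le n)).measurable

theorem MixtureData.measurable_martN (h : MixtureData μ ℱ M N v err A) (n : ℕ) :
    Measurable (N n) := ((h.martN.stronglyMeasurable n).mono (ℱ.le n)).measurable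

/-- Integrate the conditional variance; the mean of `M` does not depend on time. -/
theorem MixtureData.integral_sq_le (h : MixtureData μ ℱ M N v err A) (n : ℕ) :
    ∫ ω, (N (n + 1) ω - N n ω) ^ 2 ∂μ ≤ v n * ∫ ω, M 0 ω ∂μ + ∫ ω, |err n ω| ∂μ := by
  rw [← integral_condExp (ℱ.le n), integral_congr_ae (h.condVar n),
    integral_add ((h.martM.integrable n).const_mul _) (h.integrable_err n), integral_const_mul,
    martingale_integral_eq h.martM n]
  gcongr
  · exact h.integrable_err n
  · exact (h.integrable_err n).abs
  · exact fun ω => le_abs_self _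

theorem MixtureData.norm_interp_step (h : MixtureData μ ℱ M N v err A) {V : ℕ → ℝ}
    (hVdef : V = fun n => ∑ k ∈ Finset.range n, v k) {n k : ℕ} (hk : k < n) (hV1 : 1 ≤ V n)
    {t δ : ℝ} (hδ : 0 < δ) :
    ‖∫ ω, interp t M N V n (k + 1) ω ∂μ - ∫ ω, interp t M N V n k ω ∂μ‖
      ≤ t ^ 2 / 2 / V n * ∫ ω, |err k ω| ∂μ
        + remConst t A * ((|t| * A / √(V n) + δ) *
            (t ^ 2 / V n * (v k * ∫ ω, M 0 ω ∂μ + ∫ ω, |err k ω| ∂μ))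
          + (t ^ 2 + |t|) * A / √(V n) * (t ^ 2 / 2 / V n * (v k * ∫ ω, M 0 ω ∂μ))
          + (2 + δ⁻¹) * (t ^ 2 / 2) ^ 2 * ∫ ω, (M (k + 1) ω - M k ω) ^ 2 ∂μ) := by
  have hV0 : 0 < V n := by linarith
  have hmono : Monotone V := by
    rw [hVdef]
    exact monotone_nat_of_le_succ fun j => by
      rw [Finset.sum_range_succ]; linarith [h.v_nonneg j]
  have hVnn : ∀ j, 0 ≤ V j := fun j => by rw [hVdef]; exact Finset.sum_nonneg fun i _ => h.v_nonneg i
  have hτ : ∀ j, j ≤ n → 0 ≤ (V n - V j) / V n := fun j hj =>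
    div_nonneg (sub_nonneg.2 (hmono hj)) hV0.le
  have hsucc : V (k + 1) = V k + v k := by rw [hVdef]; exact Finset.sum_range_succ _ _
  obtain ⟨ω₀⟩ := nonempty_of_isProbabilityMeasure μ
  have hA : 0 ≤ A := (abs_nonneg _).trans (h.boundM 0 ω₀)
  have hmeas : ∀ j i, j ≤ i → StronglyMeasurable[ℱ i] (interp t M N V n j) := by
    intro j i hji
    have h1 : Measurable[ℱ i] (M j) := ((h.martM.stronglyMeasurable j).mono (ℱ.mono hji)).measurable
    have h2 : Measurable[ℱ i] (N j) := ((h.martN.stronglyMeasurable j).mono (ℱ.mono hji)).measurable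
    refine Measurable.stronglyMeasurable ?_
    refine Complex.measurable_exp.comp ?_
    fun_prop
  have hint : ∀ j, j ≤ n → Integrable (interp t M N V n j) μ := fun j hj =>
    Integrable.of_bound ((hmeas j j le_rfl).mono (ℱ.le j)).aestronglyMeasurable 1
      (ae_of_all _ fun ω => norm_interp_le_one (h.nonneg j ω) (hτ j hj))
  rw [← integral_sub (hint _ hk) (hint _ hk.le)]
  have hstep := norm_integral_mul_cexp_sub_one_le (μ := μ) (ℱ.le k) (Z := interp t M N V n k)
    (D := fun ω => N (k + 1) ω - N k ω) (P := fun ω => M (k + 1) ω - M k ω)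
    (Q := fun ω => v k * M k ω) (err := err k) (t := t) (A := A) (V := V n)
    (τ := (V n - V (k + 1)) / V n) (δ := δ) hV1 (hτ _ hk)
    (by rw [div_le_one hV0]; linarith [hVnn (k + 1)]) hδ (hmeas k k le_rfl)
    (fun ω => norm_interp_le_one (h.nonneg k ω) (hτ k hk.le))
    ((h.measurable_martN _).sub (h.measurable_martN _))
    ((h.measurable_martM _).sub (h.measurable_martM _)) ((h.measurable_martM _).const_mul _)
    (h.boundN k) (h.boundM k) (fun ω => mul_nonneg (h.v_nonneg k) (h.nonneg k ω)) (h.boundv k)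
    (martingale_condExp_sub h.martN k) (martingale_condExp_sub h.martM k) (h.integrable_err k)
    (h.condVar k)
  refine le_trans (le_of_eq ?_) (hstep.trans ?_)
  · congr 1
    refine integral_congr_ae (ae_of_all _ fun ω => ?_)
    simp only
    rw [interp_succ hsucc]
    ring
  · rw [integral_const_mul, martingale_integral_eq h.martM k]
    have hK := remConst_nonneg t hA
    have := h.integral_sq_le k
    gcongr

/-- Telescoping over `m ≤ k < n`. The sums of `v` and of the errors are enlarged to all `k < n`, but
for the increments of `M` only the tail from `m` on is counted: this is the only term with `δ⁻¹`,
and `m` makes it small. -/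
theorem MixtureData.norm_interp_sub_le (h : MixtureData μ ℱ M N v err A) {V : ℕ → ℝ}
    (hVdef : V = fun n => ∑ k ∈ Finset.range n, v k) {m n : ℕ} (hmn : m ≤ n) (hV1 : 1 ≤ V n)
    {t δ : ℝ} (hδ : 0 < δ) :
    ‖∫ ω, interp t M N V n n ω ∂μ - ∫ ω, interp t M N V n m ω ∂μ‖
      ≤ t ^ 2 / 2 * ((∑ k ∈ Finset.range n, ∫ ω, |err k ω| ∂μ) / V n)
        + remConst t A * ((|t| * A / √(V n) + δ) *
            (t ^ 2 * (∫ ω, M 0 ω ∂μ + (∑ k ∈ Finset.range n, ∫ ω, |err k ω| ∂μ) / V n))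
          + (t ^ 2 + |t|) * A / √(V n) * (t ^ 2 / 2 * ∫ ω, M 0 ω ∂μ)
          + (2 + δ⁻¹) * (t ^ 2 / 2) ^ 2 *
            ∑' j, ∫ ω, (M (j + m + 1) ω - M (j + m) ω) ^ 2 ∂μ) := by
  have hV0 : 0 < V n := by linarith
  obtain ⟨ω₀⟩ := nonempty_of_isProbabilityMeasure μ
  have hA : 0 ≤ A := (abs_nonneg _).trans (h.boundM 0 ω₀)
  have hK := remConst_nonneg t hA
  have hM0 : 0 ≤ ∫ ω, M 0 ω ∂μ := integral_nonneg (h.nonneg 0)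
  have hsub : Finset.Ico m n ⊆ Finset.range n := fun k hk =>
    Finset.mem_range.2 (Finset.mem_Ico.1 hk).2
  have hv : ∑ k ∈ Finset.Ico m n, v k ≤ V n := by
    rw [hVdef]
    exact Finset.sum_le_sum_of_subset_of_nonneg hsub fun i _ _ => h.v_nonneg i
  have he : ∑ k ∈ Finset.Ico m n, ∫ ω, |err k ω| ∂μ ≤ ∑ k ∈ Finset.range n, ∫ ω, |err k ω| ∂μ :=
    Finset.sum_le_sum_of_subset_of_nonneg hsub fun i _ _ => integral_nonneg fun ω => abs_nonneg _
  have hg : ∑ k ∈ Finset.Ico m n, ∫ ω, (M (k + 1) ω - M k ω) ^ 2 ∂μ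
      ≤ ∑' j, ∫ ω, (M (j + m + 1) ω - M (j + m) ω) ^ 2 ∂μ := by
    rw [Finset.sum_Ico_eq_sum_range]
    refine le_trans (le_of_eq ?_) (((summable_nat_add_iff m).2 h.summable).sum_le_tsum
      (Finset.range (n - m)) fun j _ => integral_nonneg fun ω => sq_nonneg _)
    exact Finset.sum_congr rfl fun j _ => by rw [add_comm m j]
  have hchain := dist_le_Ico_sum_of_dist_le (f := fun k => ∫ ω, interp t M N V n k ω ∂μ) hmn
    (d := fun k => t ^ 2 / 2 / V n * ∫ ω, |err k ω| ∂μ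
        + remConst t A * ((|t| * A / √(V n) + δ) *
            (t ^ 2 / V n * (v k * ∫ ω, M 0 ω ∂μ + ∫ ω, |err k ω| ∂μ))
          + (t ^ 2 + |t|) * A / √(V n) * (t ^ 2 / 2 / V n * (v k * ∫ ω, M 0 ω ∂μ))
          + (2 + δ⁻¹) * (t ^ 2 / 2) ^ 2 * ∫ ω, (M (k + 1) ω - M k ω) ^ 2 ∂μ))
    (fun {k} _ hkn => by
      rw [dist_comm, dist_eq_norm]
      exact h.norm_interp_step hVdef hkn hV1 (t := t) hδ)
  rw [dist_comm, dist_eq_norm] at hchain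
  refine hchain.trans ?_
  simp only [Finset.sum_add_distrib, ← Finset.mul_sum, ← Finset.sum_mul]
  set e := ∑ k ∈ Finset.Ico m n, ∫ ω, |err k ω| ∂μ
  set e' := ∑ k ∈ Finset.range n, ∫ ω, |err k ω| ∂μ
  set w := ∑ k ∈ Finset.Ico m n, v k
  set μ0 := ∫ ω, M 0 ω ∂μ
  have b1 : t ^ 2 / 2 / V n * e ≤ t ^ 2 / 2 * (e' / V n) := by
    rw [div_mul_eq_mul_div, mul_div_assoc]
    gcongr
  have b2 : t ^ 2 / V n * (w * μ0 + e) ≤ t ^ 2 * (μ0 + e' / V n) := by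
    rw [div_mul_eq_mul_div, mul_div_assoc, add_div]
    gcongr
    rw [div_le_iff₀ hV0, mul_comm μ0]
    gcongr
  have b3 : t ^ 2 / 2 / V n * (w * μ0) ≤ t ^ 2 / 2 * μ0 := by
    rw [div_mul_eq_mul_div, mul_div_assoc]
    gcongr
    rw [div_le_iff₀ hV0, mul_comm μ0]
    gcongr
  gcongr

theorem MixtureData.tendsto_integral_cexp (h : MixtureData μ ℱ M N v err A) {M' : Ω → ℝ}
    (hlim : ∀ᵐ ω ∂μ, Tendsto (fun n => M n ω) atTop (𝓝 (M' ω))) (t : ℝ) :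
    Tendsto (fun n => ∫ ω, Complex.exp
        ((t * (N n ω / √(∑ k ∈ Finset.range n, v k)) : ℝ) * Complex.I) ∂μ) atTop
      (𝓝 (∫ ω, Complex.exp ((-(t ^ 2 / 2 * M' ω) : ℝ)) ∂μ)) := by
  obtain ⟨V, hVdef⟩ : ∃ V : ℕ → ℝ, V = fun n => ∑ k ∈ Finset.range n, v k := ⟨_, rfl⟩
  have hVt : Tendsto V atTop atTop := hVdef ▸ h.tendsto_sum
  have hE : Tendsto (fun n => (∑ k ∈ Finset.range n, ∫ ω, |err k ω| ∂μ) / V n) atTop (𝓝 0) := by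
    rw [hVdef]; exact h.tendsto_err
  have hlast : ∀ n ω, interp t M N V n n ω = Complex.exp
      ((t * (N n ω / √(∑ k ∈ Finset.range n, v k)) : ℝ) * Complex.I) := by
    intro n ω
    rw [interp, sub_self, zero_div, mul_zero, mul_zero, neg_zero, Complex.ofReal_zero, add_zero,
      hVdef, div_mul_eq_mul_div, mul_div_assoc]
  simp_rw [← hlast]
  have hsqrtV : Tendsto (fun n => √(V n)) atTop atTop := Real.tendsto_sqrt_atTop.comp hVt
  set K := remConst t A
  set μ0 := ∫ ω, M 0 ω ∂μ
  set T : ℕ → ℝ := fun m => ∑' j, ∫ ω, (M (j + m + 1) ω - M (j + m) ω) ^ 2 ∂μ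
  have hT0 : Tendsto T atTop (𝓝 0) := by
    simpa [T] using tendsto_sum_nat_add fun n => ∫ ω, (M (n + 1) ω - M n ω) ^ 2 ∂μ
  have hconvM : Tendsto (fun m => ∫ ω, Complex.exp ((-(t ^ 2 / 2 * M m ω) : ℝ)) ∂μ) atTop
      (𝓝 (∫ ω, Complex.exp ((-(t ^ 2 / 2 * M' ω) : ℝ)) ∂μ)) := by
    refine tendsto_integral_of_dominated_convergence (fun _ => 1) (fun m => ?_)
      (integrable_const 1) (fun m => ae_of_all _ fun ω => ?_) ?_
    · have := h.measurable_martM m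
      refine Measurable.aestronglyMeasurable (Complex.measurable_exp.comp ?_)
      fun_prop
    · rw [Complex.norm_exp, Complex.ofReal_re, Real.exp_le_one_iff, neg_nonpos]
      exact mul_nonneg (by positivity) (h.nonneg m ω)
    · filter_upwards [hlim] with ω hω
      exact (Complex.continuous_exp.tendsto _).comp
        ((Complex.continuous_ofReal.tendsto _).comp (hω.const_mul _).neg)
  -- At fixed `m`, `N m / √(V n)` vanishes and the remaining fraction `(V n - V m) / V n` of the
  -- variance tends to one.
  have hconvN : ∀ m, Tendsto (fun n => ∫ ω, interp t M N V n m ω ∂μ) atTop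
      (𝓝 (∫ ω, Complex.exp ((-(t ^ 2 / 2 * M m ω) : ℝ)) ∂μ)) := by
    intro m
    have hmono : ∀ᶠ n in atTop, 0 ≤ (V n - V m) / V n := by
      filter_upwards [hVt.eventually_ge_atTop (V m), hVt.eventually_ge_atTop 0] with n h1 h2
      exact div_nonneg (sub_nonneg.2 h1) h2
    refine tendsto_integral_filter_of_dominated_convergence (fun _ => 1)
      (Eventually.of_forall fun n => ?_) ?_ (integrable_const 1) (ae_of_all _ fun ω => ?_)
    · have h1 := h.measurable_martM m
      have h2 := h.measurable_martN m
      refine Measurable.aestronglyMeasurable (Complex.measurable_exp.comp ?_)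
      fun_prop
    · filter_upwards [hmono] with n hn
      exact ae_of_all _ fun ω => norm_interp_le_one (h.nonneg m ω) hn
    · have h1 : Tendsto (fun n => t / √(V n) * N m ω) atTop (𝓝 0) := by
        simpa using (tendsto_const_nhds.div_atTop hsqrtV (a := t)).mul_const (N m ω)
      have h2 : Tendsto (fun n => (V n - V m) / V n) atTop (𝓝 1) := by
        have h3 : Tendsto (fun n => 1 - V m / V n) atTop (𝓝 (1 - 0)) :=
          tendsto_const_nhds.sub (tendsto_const_nhds.div_atTop hVt)
        rw [sub_zero] at h3
        refine h3.congr' ?_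
        filter_upwards [hVt.eventually_gt_atTop 0] with n hn
        field_simp
      have h4 : Tendsto (fun n => -(t ^ 2 / 2 * (M m ω * ((V n - V m) / V n)))) atTop
          (𝓝 (-(t ^ 2 / 2 * M m ω))) := by
        simpa using ((h2.const_mul (M m ω)).const_mul (t ^ 2 / 2)).neg
      have h5 := (((Complex.continuous_ofReal.tendsto _).comp h1).mul_const Complex.I).add
        ((Complex.continuous_ofReal.tendsto _).comp h4)
      rw [Complex.ofReal_zero, zero_mul, zero_add] at h5
      exact (Complex.continuous_exp.tendsto _).comp h5
  rw [Metric.tendsto_atTop']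
  intro ε hε
  -- Order of the choices: `δ` first, then `m`, since `δ⁻¹` multiplies the tail `T m`, and `n` last.
  obtain ⟨δ, hδ, hδε⟩ : ∃ δ : ℝ, 0 < δ ∧ K * (δ * (t ^ 2 * μ0)) < ε / 4 := by
    have : Tendsto (fun δ : ℝ => K * (δ * (t ^ 2 * μ0))) (𝓝[>] 0) (𝓝 (K * (0 * (t ^ 2 * μ0)))) :=
      ((tendsto_nhdsWithin_of_tendsto_nhds tendsto_id).mul_const _).const_mul _
    rw [zero_mul, mul_zero] at this
    obtain ⟨δ, h1, h2⟩ := ((this.eventually_lt_const (by positivity : 0 < ε / 4)).and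
      self_mem_nhdsWithin).exists
    exact ⟨δ, h2, h1⟩
  obtain ⟨m, hm1, hm2⟩ : ∃ m, K * ((2 + δ⁻¹) * (t ^ 2 / 2) ^ 2 * T m) < ε / 4 ∧
      dist (∫ ω, Complex.exp ((-(t ^ 2 / 2 * M m ω) : ℝ)) ∂μ)
        (∫ ω, Complex.exp ((-(t ^ 2 / 2 * M' ω) : ℝ)) ∂μ) < ε / 4 := by
    have h1 := (hT0.const_mul ((2 + δ⁻¹) * (t ^ 2 / 2) ^ 2)).const_mul K
    rw [mul_zero, mul_zero] at h1
    exact ((h1.eventually_lt_const (by positivity : 0 < ε / 4)).and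
      (Metric.tendsto_nhds.1 hconvM (ε / 4) (by positivity))).exists
  have hbound : Tendsto (fun n => t ^ 2 / 2 * ((∑ k ∈ Finset.range n, ∫ ω, |err k ω| ∂μ) / V n)
        + K * ((|t| * A / √(V n) + δ) *
            (t ^ 2 * (μ0 + (∑ k ∈ Finset.range n, ∫ ω, |err k ω| ∂μ) / V n))
          + (t ^ 2 + |t|) * A / √(V n) * (t ^ 2 / 2 * μ0)
          + (2 + δ⁻¹) * (t ^ 2 / 2) ^ 2 * T m)) atTop
      (𝓝 (t ^ 2 / 2 * 0 + K * ((0 + δ) * (t ^ 2 * (μ0 + 0)) + 0 * (t ^ 2 / 2 * μ0)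
        + (2 + δ⁻¹) * (t ^ 2 / 2) ^ 2 * T m))) := by
    have d1 : Tendsto (fun n => |t| * A / √(V n)) atTop (𝓝 0) :=
      tendsto_const_nhds.div_atTop hsqrtV
    have d2 : Tendsto (fun n => (t ^ 2 + |t|) * A / √(V n)) atTop (𝓝 0) :=
      tendsto_const_nhds.div_atTop hsqrtV
    exact (hE.const_mul _).add (((((d1.add_const δ).mul ((hE.const_add μ0).const_mul _)).add
      (d2.mul_const _)).add_const _).const_mul K)
  have hlt : t ^ 2 / 2 * 0 + K * ((0 + δ) * (t ^ 2 * (μ0 + 0)) + 0 * (t ^ 2 / 2 * μ0)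
        + (2 + δ⁻¹) * (t ^ 2 / 2) ^ 2 * T m) < ε / 2 := by
    have : t ^ 2 / 2 * 0 + K * ((0 + δ) * (t ^ 2 * (μ0 + 0)) + 0 * (t ^ 2 / 2 * μ0)
        + (2 + δ⁻¹) * (t ^ 2 / 2) ^ 2 * T m) = K * (δ * (t ^ 2 * μ0))
        + K * ((2 + δ⁻¹) * (t ^ 2 / 2) ^ 2 * T m) := by ring
    rw [this]; linarith
  have hev : ∀ᶠ n in atTop, dist (∫ ω, interp t M N V n n ω ∂μ)
      (∫ ω, Complex.exp ((-(t ^ 2 / 2 * M' ω) : ℝ)) ∂μ) < ε := by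
    filter_upwards [hbound.eventually_lt_const hlt, hVt.eventually_ge_atTop 1,
      eventually_ge_atTop m, Metric.tendsto_nhds.1 (hconvN m) (ε / 4) (by positivity)]
      with n h1 h2 h3 h4
    have h5 := h.norm_interp_sub_le hVdef h3 h2 (t := t) hδ
    rw [← dist_eq_norm] at h5
    have h6 := dist_triangle4 (∫ ω, interp t M N V n n ω ∂μ) (∫ ω, interp t M N V n m ω ∂μ)
      (∫ ω, Complex.exp ((-(t ^ 2 / 2 * M m ω) : ℝ)) ∂μ)
      (∫ ω, Complex.exp ((-(t ^ 2 / 2 * M' ω) : ℝ)) ∂μ)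
    linarith [h5.trans_lt h1]
  obtain ⟨n₀, hn₀⟩ := eventually_atTop.1 hev
  exact ⟨n₀, fun n hn => hn₀ n hn.le⟩

/-- Martingale central limit theorem with a mixing variance. -/
theorem MixtureData.tendstoNormalMixture (h : MixtureData μ ℱ M N v err A) {M' : Ω → ℝ}
    (hM' : Measurable M') (hM'0 : ∀ᵐ ω ∂μ, 0 ≤ M' ω)
    (hlim : ∀ᵐ ω ∂μ, Tendsto (fun n => M n ω) atTop (𝓝 (M' ω))) :
    TendstoNormalMixture μ (fun n ω => N n ω / √(∑ k ∈ Finset.range n, v k)) M' := by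
  have hX : ∀ n, Measurable fun ω => N n ω / √(∑ k ∈ Finset.range n, v k) :=
    fun n => (h.measurable_martN n).div_const _
  have hL : Measurable fun p : Ω × ℝ => √(M' p.1) * p.2 := by fun_prop
  refine ⟨fun n => (hX n).aemeasurable, hL.aemeasurable, ?_⟩
  refine ProbabilityMeasure.tendsto_iff_tendsto_charFun.2 fun t => ?_
  simp only [ProbabilityMeasure.coe_mk]
  -- Fubini: integrating the Gaussian coordinate first leaves the mean of `exp (-t² M' / 2)`.
  have hL' : charFun ((μ.prod (gaussianReal 0 1)).map fun p : Ω × ℝ => √(M' p.1) * p.2) t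
      = ∫ ω, Complex.exp ((-(t ^ 2 / 2 * M' ω) : ℝ)) ∂μ := by
    have hE : Measurable fun p : Ω × ℝ => Complex.exp (t * (√(M' p.1) * p.2 : ℝ) * Complex.I) := by
      refine Complex.measurable_exp.comp ?_
      fun_prop
    rw [charFun_apply_real, integral_map hL.aemeasurable (by fun_prop), integral_prod]
    · refine integral_congr_ae ?_
      filter_upwards [hM'0] with ω hω
      have hg := charFun_gaussianReal (μ := 0) (v := 1) (t * √(M' ω))
      rw [charFun_apply_real] at hg
      have hsq : ((√(M' ω) : ℝ) : ℂ) ^ 2 = (M' ω : ℂ) := by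
        rw [← Complex.ofReal_pow, Real.sq_sqrt hω]
      refine Eq.trans ?_ (hg.trans ?_)
      · congr 1
        ext x
        push_cast
        ring_nf
      · push_cast
        rw [mul_pow, hsq]
        congr 1
        ring
    · refine Integrable.of_bound hE.aestronglyMeasurable 1 (ae_of_all _ fun p => ?_)
      rw [← Complex.ofReal_mul, Complex.norm_exp_ofReal_mul_I]
  rw [hL']
  refine (h.tendsto_integral_cexp hlim t).congr fun n => ?_
  rw [charFun_apply_real, integral_map (hX n).aemeasurable (by fun_prop)]
  simp only [Complex.ofReal_mul]

/-- Slutsky's lemma; `0 ≤ c` allows `c * √S = √(c² S)`. -/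
theorem TendstoNormalMixture.mul_const_seq {X : ℕ → Ω → ℝ} {S : Ω → ℝ} {a : ℕ → ℝ} {c : ℝ}
    (h : TendstoNormalMixture μ X S) (ha : Tendsto a atTop (𝓝 c)) (hc : 0 ≤ c) :
    TendstoNormalMixture μ (fun n ω => a n * X n ω) (fun ω => c ^ 2 * S ω) := by
  have hY : TendstoInMeasure μ (fun n (_ : Ω) => a n) atTop (fun _ => c) :=
    tendstoInMeasure_of_tendsto_ae (fun n => aestronglyMeasurable_const) (ae_of_all _ fun _ => ha)
  have := TendstoInDistribution.continuous_comp_prodMk_of_tendstoInMeasure_const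
    (g := fun p : ℝ × ℝ => p.2 * p.1) (by fun_prop) h hY (fun n => aemeasurable_const)
  unfold TendstoNormalMixture
  convert this using 2 with p
  rw [Real.sqrt_mul (sq_nonneg c), Real.sqrt_sq hc, mul_assoc]

end MixtureCLT

/-! ### Asymptotics of the growth factors and of the variance weights -/

section Growth

/-- The mean growth factor after `n` trials along an eigenvector with eigenvalue `r`. -/
noncomputable def growth (r : ℝ) (n : ℕ) : ℝ := ∏ j ∈ Finset.range n, (1 + r / ((j : ℝ) + 1))

theorem growth_succ (r : ℝ) (n : ℕ) : growth r (n + 1) = growth r n * (1 + r / ((n : ℝ) + 1)) :=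
  Finset.prod_range_succ _ _

theorem growth_zero_right (r : ℝ) : growth r 0 = 1 := Finset.prod_range_zero _

theorem one_le_growth {r : ℝ} (hr : 0 ≤ r) (n : ℕ) : 1 ≤ growth r n := by
  induction n with
  | zero => rw [growth_zero_right]
  | succ n ih =>
    rw [growth_succ]
    have : 0 ≤ r / ((n : ℝ) + 1) := by positivity
    nlinarith

theorem growth_pos {r : ℝ} (hr : 0 ≤ r) (n : ℕ) : 0 < growth r n :=
  zero_lt_one.trans_le (one_le_growth hr n)

theorem growth_le_growth {r s : ℝ} (hr : 0 ≤ r) (hrs : r ≤ s) (n : ℕ) : growth r n ≤ growth s n :=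
  Finset.prod_le_prod (fun j _ => by positivity) fun j _ => by gcongr

/-- The limit of `growth r n / n ^ r`. -/
noncomputable def growthConst (r : ℝ) : ℝ := (Real.Gamma (r + 1))⁻¹

theorem growthConst_pos {r : ℝ} (hr : 0 ≤ r) : 0 < growthConst r :=
  inv_pos.2 (Real.Gamma_pos_of_pos (by linarith))

/-- For `r > 0` this is Euler's limit for the Gamma function: `r * n! * growth r n` is the product
of `r + j` over `j ≤ n`. The case `r = 0` is separate because `Γ` has a pole there. -/
theorem tendsto_growth_div_rpow {r : ℝ} (hr : 0 ≤ r) :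
    Tendsto (fun n : ℕ => growth r n / (n : ℝ) ^ r) atTop (𝓝 (growthConst r)) := by
  rcases hr.eq_or_lt with rfl | hr
  · simp [growth, growthConst]
  · have h := (Real.GammaSeq_tendsto_Gamma r).inv₀ (Real.Gamma_pos_of_pos hr).ne'
    have h2 := h.const_mul r⁻¹
    have hc : r⁻¹ * (Real.Gamma r)⁻¹ = growthConst r := by
      rw [growthConst, Real.Gamma_add_one hr.ne', mul_inv]
    rw [hc] at h2
    refine h2.congr fun n => ?_
    have hprod : ∏ j ∈ Finset.range (n + 1), (r + (j : ℝ)) = r * (n.factorial * growth r n) := by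
      rw [Finset.prod_range_succ', Nat.cast_zero, add_zero, mul_comm r]
      congr 1
      induction n with
      | zero => simp [growth]
      | succ n ih =>
        rw [Finset.prod_range_succ, ih, growth_succ, Nat.factorial_succ]
        push_cast
        field_simp
        ring
    rw [Real.GammaSeq, hprod]
    have : (n.factorial : ℝ) ≠ 0 := by positivity
    have h3 : r ≠ 0 := hr.ne'
    rcases eq_or_ne ((n : ℝ) ^ r) 0 with h0 | h0
    · rw [h0]; simp
    · field_simp

theorem tendsto_growth_succ_div_rpow {r : ℝ} (hr : 0 ≤ r) :
    Tendsto (fun n : ℕ => growth r (n + 1) / (n : ℝ) ^ r) atTop (𝓝 (growthConst r)) := by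
  have h1 : Tendsto (fun n : ℕ => 1 + r / ((n : ℝ) + 1)) atTop (𝓝 (1 + 0)) :=
    (tendsto_const_nhds.div_atTop
      (tendsto_atTop_add_const_right _ _ tendsto_natCast_atTop_atTop)).const_add 1
  have h2 := (tendsto_growth_div_rpow hr).mul h1
  rw [add_zero, mul_one] at h2
  refine h2.congr fun n => ?_
  rw [growth_succ]
  ring

/-- Telescoping: `growth ρ (n + 1) - growth ρ n = ρ * growth ρ n / (n + 1)`. -/
theorem sum_growth_div {ρ : ℝ} (hρ : ρ ≠ 0) (n : ℕ) :
    ∑ k ∈ Finset.range n, growth ρ k / ((k : ℝ) + 1) = (growth ρ n - 1) / ρ := by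
  induction n with
  | zero => simp [growth]
  | succ n ih =>
    rw [Finset.sum_range_succ, ih, growth_succ]
    field_simp
    ring

/-- The conditional variance scale of the normalized martingale. -/
noncomputable def varWeight (a b : ℝ) (k : ℕ) : ℝ :=
  growth a k / (((k : ℝ) + 1) * growth b (k + 1) ^ 2)

theorem varWeight_pos {a b : ℝ} (ha : 0 ≤ a) (hb : 0 ≤ b) (k : ℕ) : 0 < varWeight a b k := by
  have := growth_pos ha k
  have := growth_pos hb (k + 1)
  unfold varWeight
  positivity

/-- The weight has order `n ^ (a - 2b - 1)`, and `a < 2b` makes this exponent less than `-1`. -/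
theorem summable_varWeight {a b : ℝ} (ha : 0 ≤ a) (hb : 0 ≤ b) (hab : a < 2 * b) :
    Summable (varWeight a b) := by
  have hlim : Tendsto (fun n : ℕ => varWeight a b n / ((n : ℝ) ^ (1 + 2 * b - a))⁻¹) atTop
      (𝓝 (growthConst a / growthConst b ^ 2 * 1)) := by
    have h1 : Tendsto (fun n : ℕ => (n : ℝ) / ((n : ℝ) + 1)) atTop (𝓝 1) :=
      tendsto_natCast_div_add_atTop 1
    have h2 := ((tendsto_growth_div_rpow ha).div ((tendsto_growth_succ_div_rpow hb).pow 2)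
      (pow_pos (growthConst_pos hb) 2).ne').mul h1
    refine h2.congr' ?_
    filter_upwards [eventually_gt_atTop 0] with n hn
    have hn' : (0 : ℝ) < n := Nat.cast_pos.2 hn
    have e : (n : ℝ) ^ (1 + 2 * b - a) = n * ((n : ℝ) ^ b) ^ 2 / (n : ℝ) ^ a := by
      rw [Real.rpow_sub hn', Real.rpow_add hn', Real.rpow_one, ← Real.rpow_natCast,
        ← Real.rpow_mul hn'.le]
      congr 3
      push_cast
      ring
    have := growth_pos hb (n + 1)
    have h3 : (0 : ℝ) < (n : ℝ) ^ a := Real.rpow_pos_of_pos hn' _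
    have h4 : (0 : ℝ) < (n : ℝ) ^ b := Real.rpow_pos_of_pos hn' _
    simp only [Pi.div_apply]
    rw [e, varWeight]
    field_simp
  refine summable_of_isBigO_nat (Real.summable_nat_rpow_inv.2 (by linarith : 1 < 1 + 2 * b - a)) ?_
  refine Asymptotics.isBigO_of_div_tendsto_nhds ?_ _ hlim
  filter_upwards [eventually_gt_atTop 0] with n hn h0
  exact absurd h0 (inv_pos.2 (Real.rpow_pos_of_pos (Nat.cast_pos.2 hn) _)).ne'

/-- Stolz–Cesàro for partial sums. -/
theorem tendsto_sum_div_sum {u w : ℕ → ℝ} {c : ℝ} (hw : ∀ n, 0 < w n)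
    (hW : Tendsto (fun n => ∑ k ∈ Finset.range n, w k) atTop atTop)
    (h : Tendsto (fun n => u n / w n) atTop (𝓝 c)) :
    Tendsto (fun n => (∑ k ∈ Finset.range n, u k) / ∑ k ∈ Finset.range n, w k) atTop (𝓝 c) := by
  have ho : (fun n => u n - c * w n) =o[atTop] w := by
    refine (Asymptotics.isLittleO_iff_tendsto fun n hn => absurd hn (hw n).ne').2 ?_
    have := h.sub_const c
    rw [sub_self] at this
    refine this.congr fun n => ?_
    have := (hw n).ne'
    field_simp
  have h2 := (ho.sum_range (fun n => (hw n).le) hW).tendsto_div_nhds_zero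
  have h3 := h2.add_const c
  rw [zero_add] at h3
  refine h3.congr' ?_
  filter_upwards [hW.eventually_gt_atTop 0] with n hn
  rw [Finset.sum_sub_distrib, ← Finset.mul_sum]
  field_simp
  ring

/-- The comparison weights `growth (a - 2b) k / (k + 1)` have the same order, and their partial sums
are explicit: they telescope if `a > 2b` and are harmonic numbers if `a = 2b`. -/
theorem tendsto_varWeight_div {a b : ℝ} (hb : 0 ≤ b) (hab : 2 * b ≤ a) :
    Tendsto (fun k : ℕ => varWeight a b k / (growth (a - 2 * b) k / ((k : ℝ) + 1))) atTop
      (𝓝 (growthConst a / (growthConst b ^ 2 * growthConst (a - 2 * b)))) := by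
  have ha : 0 ≤ a := by linarith
  have hρ : 0 ≤ a - 2 * b := by linarith
  have h2 := (tendsto_growth_div_rpow ha).div (((tendsto_growth_succ_div_rpow hb).pow 2).mul
      (tendsto_growth_div_rpow hρ))
      (mul_pos (pow_pos (growthConst_pos hb) 2) (growthConst_pos hρ)).ne'
  refine h2.congr' ?_
  filter_upwards [eventually_gt_atTop 0] with n hn
  have hn' : (0 : ℝ) < n := Nat.cast_pos.2 hn
  have e : (n : ℝ) ^ a = ((n : ℝ) ^ b) ^ 2 * (n : ℝ) ^ (a - 2 * b) := by
    rw [← Real.rpow_natCast, ← Real.rpow_mul hn'.le, ← Real.rpow_add hn']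
    congr 1
    push_cast
    ring
  have := growth_pos hb (n + 1)
  have := growth_pos hρ n
  have h3 : (0 : ℝ) < (n : ℝ) ^ (a - 2 * b) := Real.rpow_pos_of_pos hn' _
  have h4 : (0 : ℝ) < (n : ℝ) ^ b := Real.rpow_pos_of_pos hn' _
  simp only [Pi.div_apply]
  rw [e, varWeight]
  field_simp

/-- In the regime `2 * b ≤ a` the variance weights sum up to a quantity comparable to `ℓ`. -/
theorem tendsto_growth_sq_mul_sum {a b c : ℝ} (hb : 0 ≤ b) (hab : 2 * b ≤ a) {ℓ : ℕ → ℝ}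
    (hW : Tendsto (fun n => ∑ k ∈ Finset.range n, growth (a - 2 * b) k / ((k : ℝ) + 1)) atTop atTop)
    (hℓ : Tendsto (fun n => (∑ k ∈ Finset.range n, growth (a - 2 * b) k / ((k : ℝ) + 1)) / ℓ n)
      atTop (𝓝 (growthConst (a - 2 * b) * c))) :
    Tendsto (fun n => ∑ k ∈ Finset.range n, varWeight a b k) atTop atTop ∧
    Tendsto (fun n : ℕ => growth b n ^ 2 * (∑ k ∈ Finset.range n, varWeight a b k) /
      (((n : ℝ) ^ b) ^ 2 * ℓ n)) atTop (𝓝 (growthConst a * c)) := by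
  have ha : 0 ≤ a := by linarith
  have hρ : 0 ≤ a - 2 * b := by linarith
  have hw : ∀ k : ℕ, 0 < growth (a - 2 * b) k / ((k : ℝ) + 1) := fun k => by
    have := growth_pos hρ k
    positivity
  have h1 := tendsto_sum_div_sum hw hW (tendsto_varWeight_div hb hab)
  have hγa := growthConst_pos ha
  have hγb := growthConst_pos hb
  have hγρ := growthConst_pos hρ
  refine ⟨?_, ?_⟩
  · refine (h1.pos_mul_atTop (by positivity) hW).congr' ?_
    filter_upwards [hW.eventually_gt_atTop 0] with n hn
    exact div_mul_cancel₀ _ hn.ne'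
  · have h2 := (((tendsto_growth_div_rpow hb).pow 2).mul h1).mul hℓ
    -- Only `growthConst a` survives. It is the factor that turns the limit of the first martingale
    -- into `V₁`.
    have e : growthConst b ^ 2 * (growthConst a / (growthConst b ^ 2 * growthConst (a - 2 * b))) *
        (growthConst (a - 2 * b) * c) = growthConst a * c := by
      field_simp
    rw [e] at h2
    refine h2.congr' ?_
    filter_upwards [hW.eventually_gt_atTop 0] with n hn
    rw [div_pow, div_mul_div_comm, div_mul_div_comm,
      mul_right_comm (((n : ℝ) ^ b) ^ 2), mul_div_mul_right _ _ hn.ne']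

theorem tendsto_sum_growth_div_rpow {ρ : ℝ} (hρ : 0 < ρ) :
    Tendsto (fun n : ℕ => (∑ k ∈ Finset.range n, growth ρ k / ((k : ℝ) + 1)) / (n : ℝ) ^ ρ) atTop
      (𝓝 (growthConst ρ * ρ⁻¹)) := by
  have h0 : Tendsto (fun n : ℕ => (n : ℝ) ^ ρ) atTop atTop :=
    (tendsto_rpow_atTop hρ).comp tendsto_natCast_atTop_atTop
  have h1 := ((tendsto_growth_div_rpow hρ.le).sub (tendsto_const_nhds (x := (1 : ℝ)).div_atTop
    h0)).mul_const ρ⁻¹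
  rw [sub_zero] at h1
  refine h1.congr fun n => ?_
  rw [sum_growth_div hρ.ne']
  ring

theorem tendsto_sum_growth_atTop {ρ : ℝ} (hρ : 0 < ρ) :
    Tendsto (fun n : ℕ => ∑ k ∈ Finset.range n, growth ρ k / ((k : ℝ) + 1)) atTop atTop := by
  have h0 : Tendsto (fun n : ℕ => (n : ℝ) ^ ρ) atTop atTop :=
    (tendsto_rpow_atTop hρ).comp tendsto_natCast_atTop_atTop
  refine ((tendsto_sum_growth_div_rpow hρ).pos_mul_atTop
    (mul_pos (growthConst_pos hρ.le) (inv_pos.2 hρ)) h0).congr' ?_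
  filter_upwards [h0.eventually_gt_atTop 0] with n hn
  exact div_mul_cancel₀ _ hn.ne'

theorem sum_growth_zero (n : ℕ) :
    ∑ k ∈ Finset.range n, growth 0 k / ((k : ℝ) + 1) = harmonic n := by
  simp [growth, harmonic]

theorem tendsto_log_natCast : Tendsto (fun n : ℕ => Real.log n) atTop atTop :=
  Real.tendsto_log_atTop.comp tendsto_natCast_atTop_atTop

theorem tendsto_sum_growth_zero_div_log :
    Tendsto (fun n : ℕ => (∑ k ∈ Finset.range n, growth 0 k / ((k : ℝ) + 1)) / Real.log n) atTop
      (𝓝 (growthConst 0 * 1)) := by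
  have h1 := (Real.tendsto_harmonic_sub_log.div_atTop tendsto_log_natCast).add_const 1
  have e : growthConst 0 * 1 = 0 + 1 := by simp [growthConst]
  rw [e]
  refine h1.congr' ?_
  filter_upwards [tendsto_log_natCast.eventually_gt_atTop 0] with n hn
  rw [sum_growth_zero]
  field_simp
  ring

theorem tendsto_sum_growth_zero_atTop :
    Tendsto (fun n : ℕ => ∑ k ∈ Finset.range n, growth 0 k / ((k : ℝ) + 1)) atTop atTop := by
  refine (tendsto_sum_growth_zero_div_log.pos_mul_atTop (by simp [growthConst])
    tendsto_log_natCast).congr' ?_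
  filter_upwards [tendsto_log_natCast.eventually_gt_atTop 0] with n hn
  exact div_mul_cancel₀ _ hn.ne'

end Growth

/-! ### Urns with a right eigenvector: martingale and conditional variance -/

section Draws

variable {Ω ι : Type*} [mΩ : MeasurableSpace Ω] {μ : Measure Ω} [IsProbabilityMeasure μ]
  [Fintype ι] [DecidableEq ι] [MeasurableSpace ι] [DiscreteMeasurableSpace ι]
  {R : Matrix ι ι ℝ} {c₀ : ι → ℝ} {I : ℕ → Ω → ι}

set_option linter.unusedSectionVars false

theorem history_mono {m n : ℕ} (hmn : m ≤ n) : history I m ≤ history I n :=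
  iSup₂_le fun k hk => le_iSup₂_of_le k
    (Finset.mem_range.2 ((Finset.mem_range.1 hk).trans_le hmn)) le_rfl

theorem history_le (hI : ∀ n, Measurable (I n)) (n : ℕ) : history I n ≤ mΩ :=
  iSup₂_le fun k _ => (hI k).comap_le

/-- The filtration generated by the draws. -/
def drawFiltration (hI : ∀ n, Measurable (I n)) : Filtration ℕ mΩ where
  seq := history I
  mono' _ _ h := history_mono h
  le' := history_le hI

theorem measurable_draw_history (n : ℕ) : Measurable[history I (n + 1)] (I n) := by
  have h : MeasurableSpace.comap (I n) inferInstance ≤ history I (n + 1) :=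
    le_iSup₂_of_le n (Finset.mem_range.2 n.lt_succ_self) le_rfl
  exact (comap_measurable (I n)).mono h le_rfl

theorem measurable_count (R : Matrix ι ι ℝ) (c₀ : ι → ℝ) (I : ℕ → Ω → ι) (n : ℕ) (i : ι) :
    Measurable[history I n] fun ω => count R c₀ I n ω i := by
  induction n with
  | zero => exact measurable_const
  | succ n ih =>
    have h1 : Measurable[history I (n + 1)] fun ω => count R c₀ I n ω i :=
      ih.mono (history_mono n.le_succ) le_rfl
    have h2 : Measurable[history I (n + 1)] fun ω => R (I n ω) i :=
      (Measurable.of_discrete (f := fun j => R j i)).comp (measurable_draw_history n)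
    exact h1.add h2

theorem count_nonneg (hR : ∀ i j, 0 ≤ R i j) (hc₀ : ∀ i, 0 ≤ c₀ i) (n : ℕ) (ω : Ω) (i : ι) :
    0 ≤ count R c₀ I n ω i := by
  induction n with
  | zero => exact hc₀ i
  | succ n ih => exact add_nonneg ih (hR _ _)

theorem sum_count (hR : ∀ i, ∑ j, R i j = 1) (hc₀ : ∑ i, c₀ i = 1) (n : ℕ) (ω : Ω) :
    ∑ i, count R c₀ I n ω i = n + 1 := by
  induction n with
  | zero => simpa [count] using hc₀
  | succ n ih =>
    have : ∀ i, count R c₀ I (n + 1) ω i = count R c₀ I n ω i + R (I n ω) i := fun i => rfl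
    simp_rw [this, Finset.sum_add_distrib, ih, hR]
    push_cast
    rfl

/-- Conditional expectation given the past of a function of the past and the next draw. -/
theorem IsDrawSequence.condExp_draw (h : IsDrawSequence μ R c₀ I) {n : ℕ} {f : ι → Ω → ℝ} {B : ℝ}
    (hf : ∀ i, StronglyMeasurable[history I n] (f i)) (hB : ∀ i ω, |f i ω| ≤ B) :
    μ[fun ω => f (I n ω) ω | history I n] =ᵐ[μ]
      fun ω => ∑ i, f i ω * (count R c₀ I n ω i / ((n : ℝ) + 1)) := by
  have hle : history I n ≤ mΩ := history_le h.measurable_draw n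
  have hind : ∀ i, Measurable ((I n ⁻¹' {i}).indicator (fun _ => (1 : ℝ))) := fun i =>
    measurable_const.indicator (h.measurable_draw n (measurableSet_singleton i))
  have hindi : ∀ i, Integrable ((I n ⁻¹' {i}).indicator (fun _ => (1 : ℝ))) μ := fun i =>
    (integrable_const (1 : ℝ)).indicator (h.measurable_draw n (measurableSet_singleton i))
  have hfi : ∀ i, Integrable (f i * (I n ⁻¹' {i}).indicator (fun _ => (1 : ℝ))) μ := fun i =>
    (hindi i).bdd_mul ((hf i).mono hle).aestronglyMeasurable (ae_of_all _ (hB i))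
  have heq : (fun ω => f (I n ω) ω)
      = ∑ i, f i * (I n ⁻¹' {i}).indicator (fun _ => (1 : ℝ)) := by
    ext ω
    rw [Finset.sum_apply, Finset.sum_eq_single (I n ω)]
    · simp
    · intro i _ hi
      simp [Set.indicator, hi.symm]
    · simp
  rw [heq]
  refine (condExp_finsetSum (fun i _ => hfi i) _).trans ?_
  have hall : ∀ᵐ ω ∂μ, ∀ i, (μ[f i * (I n ⁻¹' {i}).indicator (fun _ => (1 : ℝ)) | history I n]) ω
      = f i ω * (count R c₀ I n ω i / ((n : ℝ) + 1)) := by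
    rw [ae_all_iff]
    intro i
    filter_upwards [condExp_mul_of_stronglyMeasurable_left (μ := μ) (hf i) (hfi i) (hindi i),
      h.condProb_draw n i] with ω h1 h2
    rw [h1, Pi.mul_apply, h2]
  filter_upwards [hall] with ω hω
  rw [Finset.sum_apply]
  exact Finset.sum_congr rfl fun i _ => hω i

/-- The hypotheses on a balanced urn with a right eigenvector `u` of the replacement matrix. -/
structure EigenUrn (μ : Measure Ω) (R : Matrix ι ι ℝ) (c₀ : ι → ℝ) (I : ℕ → Ω → ι) (r : ℝ)
    (u : ι → ℝ) (U : ℝ) : Prop where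
  draw : IsDrawSequence μ R c₀ I
  R_nonneg : ∀ i j, 0 ≤ R i j
  R_sum : ∀ i, ∑ j, R i j = 1
  c_nonneg : ∀ i, 0 ≤ c₀ i
  c_sum : ∑ i, c₀ i = 1
  eigen : R *ᵥ u = r • u
  r_nonneg : 0 ≤ r
  bound : ∀ i, |u i| ≤ U

/-- The normalized linear statistic of the urn along `u`. -/
noncomputable def eigenMart (R : Matrix ι ι ℝ) (c₀ : ι → ℝ) (I : ℕ → Ω → ι) (r : ℝ) (u : ι → ℝ)
    (n : ℕ) (ω : Ω) : ℝ := (count R c₀ I n ω ⬝ᵥ u) / growth r n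

variable {r U : ℝ} {u : ι → ℝ}

theorem measurable_count_dotProduct (R : Matrix ι ι ℝ) (c₀ : ι → ℝ) (I : ℕ → Ω → ι) (u : ι → ℝ)
    (n : ℕ) : Measurable[history I n] fun ω => count R c₀ I n ω ⬝ᵥ u :=
  Finset.measurable_fun_sum _ fun i _ => (measurable_count R c₀ I n i).mul_const _

theorem EigenUrn.abs_dotProduct_le (h : EigenUrn μ R c₀ I r u U) {w : ι → ℝ} {W : ℝ}
    (hw : ∀ i, |w i| ≤ W) (n : ℕ) (ω : Ω) :
    |count R c₀ I n ω ⬝ᵥ w| ≤ W * ((n : ℝ) + 1) := by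
  rw [dotProduct]
  refine (Finset.abs_sum_le_sum_abs _ _).trans ?_
  rw [← sum_count h.R_sum h.c_sum n ω (I := I), Finset.mul_sum]
  refine Finset.sum_le_sum fun i _ => ?_
  have h0 := count_nonneg h.R_nonneg h.c_nonneg n ω i (I := I)
  rw [abs_mul, abs_of_nonneg h0, mul_comm]
  gcongr
  exact hw i

theorem EigenUrn.abs_div_le (h : EigenUrn μ R c₀ I r u U) (n : ℕ) (ω : Ω) :
    |(count R c₀ I n ω ⬝ᵥ u) / ((n : ℝ) + 1)| ≤ U := by
  have hn : (0 : ℝ) < (n : ℝ) + 1 := by positivity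
  rw [abs_div, abs_of_pos hn, div_le_iff₀ hn]
  exact h.abs_dotProduct_le h.bound n ω

/-- As `R u = r u`, drawing colour `i` adds `r * u i` to the statistic, and the factor `1 + r / (n +
1)` in `growth` removes exactly the conditional mean of this addition. -/
theorem EigenUrn.eigenMart_succ_sub (h : EigenUrn μ R c₀ I r u U) (n : ℕ) (ω : Ω) :
    eigenMart R c₀ I r u (n + 1) ω - eigenMart R c₀ I r u n ω
      = r / growth r (n + 1) * (u (I n ω) - (count R c₀ I n ω ⬝ᵥ u) / ((n : ℝ) + 1)) := by
  have h1 : count R c₀ I (n + 1) ω ⬝ᵥ u = count R c₀ I n ω ⬝ᵥ u + r * u (I n ω) := by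
    have h2 : R (I n ω) ⬝ᵥ u = r * u (I n ω) := congrFun h.eigen (I n ω)
    rw [count, add_dotProduct, h2]
  have hg := (growth_pos h.r_nonneg n).ne'
  have hr := h.r_nonneg
  have hn : (0 : ℝ) < (n : ℝ) + 1 := by positivity
  have hn2 : (n : ℝ) + 1 + r ≠ 0 := by positivity
  rw [eigenMart, eigenMart, h1, growth_succ]
  field_simp
  ring

theorem EigenUrn.abs_eigenMart_succ_sub_le (h : EigenUrn μ R c₀ I r u U) (n : ℕ) (ω : Ω) :
    |eigenMart R c₀ I r u (n + 1) ω - eigenMart R c₀ I r u n ω| ≤ r * (2 * U) := by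
  have hg := one_le_growth h.r_nonneg (n + 1)
  have hr := h.r_nonneg
  rw [h.eigenMart_succ_sub, abs_mul, abs_of_nonneg (by positivity)]
  have h1 := abs_sub (u (I n ω)) ((count R c₀ I n ω ⬝ᵥ u) / ((n : ℝ) + 1))
  have h2 := h.abs_div_le n ω
  have h3 := h.bound (I n ω)
  exact mul_le_mul (div_le_self hr hg) (by linarith) (abs_nonneg _) hr

theorem EigenUrn.measurable_eigenMart_history (R : Matrix ι ι ℝ) (c₀ : ι → ℝ) (I : ℕ → Ω → ι)
    (r : ℝ) (u : ι → ℝ) (n : ℕ) : Measurable[history I n] (eigenMart R c₀ I r u n) :=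
  (measurable_count_dotProduct R c₀ I u n).div_const _

theorem EigenUrn.memLp_eigenMart (h : EigenUrn μ R c₀ I r u U) (n : ℕ) :
    MemLp (eigenMart R c₀ I r u n) 2 μ := by
  have hm : Measurable (eigenMart R c₀ I r u n) :=
    (EigenUrn.measurable_eigenMart_history R c₀ I r u n).mono
      (history_le h.draw.measurable_draw n) le_rfl
  refine MemLp.of_bound hm.aestronglyMeasurable (U * ((n : ℝ) + 1) / growth r n)
    (ae_of_all _ fun ω => ?_)
  have hg := growth_pos h.r_nonneg n
  rw [eigenMart, Real.norm_eq_abs, abs_div, abs_of_pos hg]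
  have := h.abs_dotProduct_le h.bound n ω
  gcongr

theorem EigenUrn.condExp_sub_eq_zero (h : EigenUrn μ R c₀ I r u U) (n : ℕ) :
    μ[fun ω => eigenMart R c₀ I r u (n + 1) ω - eigenMart R c₀ I r u n ω | history I n]
      =ᵐ[μ] 0 := by
  simp_rw [h.eigenMart_succ_sub]
  have hm := (measurable_count_dotProduct R c₀ I u n).div_const ((n : ℝ) + 1)
  have hr := h.r_nonneg
  have hg := one_le_growth h.r_nonneg (n + 1)
  refine (h.draw.condExp_draw (n := n) (f := fun i ω => r / growth r (n + 1) *
    (u i - (count R c₀ I n ω ⬝ᵥ u) / ((n : ℝ) + 1))) (B := r * (2 * U))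
    (fun i => ((hm.const_sub _).const_mul _).stronglyMeasurable) fun i ω => ?_).trans ?_
  · rw [abs_mul, abs_of_nonneg (by positivity)]
    have h1 := abs_sub (u i) ((count R c₀ I n ω ⬝ᵥ u) / ((n : ℝ) + 1))
    have h2 := h.abs_div_le n ω
    have h3 := h.bound i
    exact mul_le_mul (div_le_self hr hg) (by linarith) (abs_nonneg _) hr
  · refine ae_of_all _ fun ω => ?_
    simp only [Pi.zero_apply]
    have hs := sum_count h.R_sum h.c_sum n ω (I := I)
    have hn : (n : ℝ) + 1 ≠ 0 := by positivity
    set y := (count R c₀ I n ω ⬝ᵥ u) with hy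
    have e : ∀ i, r / growth r (n + 1) * (u i - y / ((n : ℝ) + 1)) *
        (count R c₀ I n ω i / ((n : ℝ) + 1)) = r / growth r (n + 1) / ((n : ℝ) + 1) *
          (count R c₀ I n ω i * u i - y / ((n : ℝ) + 1) * count R c₀ I n ω i) := fun i => by ring
    simp_rw [e]
    rw [← Finset.mul_sum, Finset.sum_sub_distrib, ← Finset.mul_sum, hs, div_mul_cancel₀ _ hn]
    rw [hy, dotProduct, sub_self, mul_zero]

theorem EigenUrn.martingale (h : EigenUrn μ R c₀ I r u U) :
    Martingale (eigenMart R c₀ I r u) (drawFiltration h.draw.measurable_draw) μ :=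
  martingale_of_condExp_sub_eq_zero_nat
    (fun n => (EigenUrn.measurable_eigenMart_history R c₀ I r u n).stronglyMeasurable)
    (fun n => (h.memLp_eigenMart n).integrable (by norm_num)) h.condExp_sub_eq_zero

/-- The bracket is the variance of `u` under the law of the next draw, whose weights `count / (n +
1)` sum to one. -/
theorem EigenUrn.condExp_sq (h : EigenUrn μ R c₀ I r u U) (n : ℕ) :
    μ[fun ω => (eigenMart R c₀ I r u (n + 1) ω - eigenMart R c₀ I r u n ω) ^ 2 | history I n]
      =ᵐ[μ] fun ω => (r / growth r (n + 1)) ^ 2 * ((count R c₀ I n ω ⬝ᵥ (u ^ 2)) / ((n : ℝ) + 1)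
        - ((count R c₀ I n ω ⬝ᵥ u) / ((n : ℝ) + 1)) ^ 2) := by
  simp_rw [h.eigenMart_succ_sub]
  have hm := (measurable_count_dotProduct R c₀ I u n).div_const ((n : ℝ) + 1)
  have hr := h.r_nonneg
  have hg := one_le_growth h.r_nonneg (n + 1)
  refine (h.draw.condExp_draw (n := n) (f := fun i ω => (r / growth r (n + 1) *
    (u i - (count R c₀ I n ω ⬝ᵥ u) / ((n : ℝ) + 1))) ^ 2) (B := (r * (2 * U)) ^ 2)
    (fun i => (((hm.const_sub _).const_mul _).pow_const 2).stronglyMeasurable) fun i ω => ?_).trans ?_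
  · rw [abs_pow]
    refine pow_le_pow_left₀ (abs_nonneg _) ?_ 2
    rw [abs_mul, abs_of_nonneg (by positivity)]
    have h1 := abs_sub (u i) ((count R c₀ I n ω ⬝ᵥ u) / ((n : ℝ) + 1))
    have h2 := h.abs_div_le n ω
    have h3 := h.bound i
    exact mul_le_mul (div_le_self hr hg) (by linarith) (abs_nonneg _) hr
  · refine ae_of_all _ fun ω => ?_
    beta_reduce
    have hs := sum_count h.R_sum h.c_sum n ω (I := I)
    have hn : (n : ℝ) + 1 ≠ 0 := by positivity
    set y := (count R c₀ I n ω ⬝ᵥ u) with hy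
    have e : ∀ i, (r / growth r (n + 1) * (u i - y / ((n : ℝ) + 1))) ^ 2 *
        (count R c₀ I n ω i / ((n : ℝ) + 1)) = (r / growth r (n + 1)) ^ 2 / ((n : ℝ) + 1) *
          (count R c₀ I n ω i * u i ^ 2 - 2 * (y / ((n : ℝ) + 1)) * (count R c₀ I n ω i * u i)
            + (y / ((n : ℝ) + 1)) ^ 2 * count R c₀ I n ω i) := fun i => by ring
    simp_rw [e]
    rw [← Finset.mul_sum, Finset.sum_add_distrib, Finset.sum_sub_distrib, ← Finset.mul_sum,
      ← Finset.mul_sum, hs]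
    have e1 : ∑ i, count R c₀ I n ω i * u i = y := rfl
    have e2 : count R c₀ I n ω ⬝ᵥ (u ^ 2) = ∑ i, count R c₀ I n ω i * u i ^ 2 := rfl
    rw [e1, e2]
    field_simp
    ring

theorem EigenUrn.integral_dotProduct (h : EigenUrn μ R c₀ I r u U) (n : ℕ) :
    ∫ ω, count R c₀ I n ω ⬝ᵥ u ∂μ = (c₀ ⬝ᵥ u) * growth r n := by
  have hg := (growth_pos h.r_nonneg n).ne'
  have h1 := martingale_integral_eq h.martingale n
  have h2 : ∀ ω, count R c₀ I n ω ⬝ᵥ u = eigenMart R c₀ I r u n ω * growth r n := fun ω => by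
    rw [eigenMart, div_mul_cancel₀ _ hg]
  have h3 : ∀ ω, eigenMart R c₀ I r u 0 ω = c₀ ⬝ᵥ u := fun ω => by
    rw [eigenMart, growth_zero_right, div_one, count]
  simp_rw [h2]
  rw [integral_mul_const, h1]
  simp [h3]

theorem EigenUrn.integrable_dotProduct (h : EigenUrn μ R c₀ I r u U) (w : ι → ℝ) (n : ℕ) :
    Integrable (fun ω => count R c₀ I n ω ⬝ᵥ w) μ := by
  have hm := (measurable_count_dotProduct R c₀ I w n).mono
    (history_le h.draw.measurable_draw n) le_rfl
  refine Integrable.of_bound hm.aestronglyMeasurable ((∑ i, |w i|) * ((n : ℝ) + 1))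
    (ae_of_all _ fun ω => ?_)
  exact h.abs_dotProduct_le (fun i => Finset.single_le_sum (f := fun i => |w i|)
    (fun _ _ => abs_nonneg _) (Finset.mem_univ i)) n ω

/-- The squared conditional mean is dropped, so the growth of the mean of `u²` decides whether the
increments are summable in `L²`. -/
theorem EigenUrn.integral_sq_le (h : EigenUrn μ R c₀ I r u U) {a K : ℝ} {n : ℕ}
    (hK : ∫ ω, count R c₀ I n ω ⬝ᵥ (u ^ 2) ∂μ ≤ K * growth a n) :
    ∫ ω, (eigenMart R c₀ I r u (n + 1) ω - eigenMart R c₀ I r u n ω) ^ 2 ∂μ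
      ≤ r ^ 2 * K * varWeight a r n := by
  have hg := growth_pos h.r_nonneg (n + 1)
  have hn : (0 : ℝ) < (n : ℝ) + 1 := by positivity
  have hm := (measurable_count_dotProduct R c₀ I u n).mono
    (history_le h.draw.measurable_draw n) le_rfl
  have hsq : Integrable (fun ω => ((count R c₀ I n ω ⬝ᵥ u) / ((n : ℝ) + 1)) ^ 2) μ := by
    refine Integrable.of_bound ((hm.div_const _).pow_const 2).aestronglyMeasurable (U ^ 2)
      (ae_of_all _ fun ω => ?_)
    rw [norm_pow]
    exact pow_le_pow_left₀ (norm_nonneg _) (h.abs_div_le n ω) 2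
  have hi := (h.integrable_dotProduct (u ^ 2) n).div_const ((n : ℝ) + 1)
  rw [← integral_condExp (history_le h.draw.measurable_draw n),
    integral_congr_ae (h.condExp_sq n), integral_const_mul, integral_sub hi hsq, integral_div]
  have h0 : 0 ≤ ∫ ω, ((count R c₀ I n ω ⬝ᵥ u) / ((n : ℝ) + 1)) ^ 2 ∂μ :=
    integral_nonneg fun ω => sq_nonneg _
  calc _ ≤ (r / growth r (n + 1)) ^ 2 * (K * growth a n / ((n : ℝ) + 1)) := by
        gcongr
        have : (∫ ω, count R c₀ I n ω ⬝ᵥ (u ^ 2) ∂μ) / ((n : ℝ) + 1) ≤ K * growth a n / ((n : ℝ) + 1) := by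
          gcongr
        linarith
    _ = _ := by
        rw [varWeight]
        field_simp

/-- A limit of the normalized statistic is not constant when `u` is not constant. -/
theorem EigenUrn.nondegenerate (h : EigenUrn μ R c₀ I r u U) (hr : 0 < r) {i j : ι}
    (hi : 0 < c₀ i) (hj : 0 < c₀ j) (hij : u i ≠ u j) {g : Ω → ℝ}
    (hg : TendstoAEAndL2 μ (eigenMart R c₀ I r u) g) : Nondegenerate μ g := by
  intro c hc
  have h0 := Martingale.ae_eq_const_of_limit h.martingale hg hc 0
  have h1 := Martingale.ae_eq_const_of_limit h.martingale hg hc 1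
  have hgr := (growth_pos h.r_nonneg (0 + 1)).ne'
  -- A constant limit forces a constant martingale, so the first increment vanishes and `u` of the
  -- first draw is almost surely its mean. Every colour with positive initial content is drawn first
  -- with positive probability, so `u` takes that value on all of them.
  have hu : ∀ᵐ ω ∂μ, u (I 0 ω) = c₀ ⬝ᵥ u := by
    filter_upwards [h0, h1] with ω h0 h1
    have h2 := h.eigenMart_succ_sub 0 ω
    rw [zero_add] at h2
    rw [h0, h1, sub_self] at h2
    have h3 := (mul_eq_zero.1 h2.symm).resolve_left (div_ne_zero hr.ne' hgr)
    simpa [count, sub_eq_zero] using h3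
  have hval : ∀ k, 0 < c₀ k → u k = c₀ ⬝ᵥ u := by
    intro k hk
    by_contra hne
    have hmeas : MeasurableSet (I 0 ⁻¹' {k}) := h.draw.measurable_draw 0 (measurableSet_singleton k)
    have hz : (I 0 ⁻¹' {k}).indicator (fun _ => (1 : ℝ)) =ᵐ[μ] 0 := by
      filter_upwards [hu] with ω hω
      have : ω ∉ I 0 ⁻¹' {k} := fun hmem => hne (by rw [← hω, Set.mem_singleton_iff.1 hmem])
      simp [this]
    have hint : ∫ ω, (I 0 ⁻¹' {k}).indicator (fun _ => (1 : ℝ)) ω ∂μ = c₀ k := by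
      rw [← integral_condExp (history_le h.draw.measurable_draw 0),
        integral_congr_ae (h.draw.condProb_draw 0 k)]
      simp [count]
    rw [integral_congr_ae hz] at hint
    simp at hint
    linarith
  exact hij ((hval i hi).trans (hval j hj).symm)

/-- The second moments of the increments are at most a multiple of `varWeight a r`, which is
summable when `a < 2r`. -/
theorem EigenUrn.tendsto_limit (h : EigenUrn μ R c₀ I r u U) {a K : ℝ} (ha : 0 ≤ a)
    (har : a < 2 * r) (hK : ∀ n, ∫ ω, count R c₀ I n ω ⬝ᵥ (u ^ 2) ∂μ ≤ K * growth a n) :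
    ∃ g : Ω → ℝ, Measurable g ∧ TendstoAEAndL2 μ (eigenMart R c₀ I r u) g ∧
      Summable fun n =>
        ∫ ω, (eigenMart R c₀ I r u (n + 1) ω - eigenMart R c₀ I r u n ω) ^ 2 ∂μ := by
  have hs : Summable fun n =>
      ∫ ω, (eigenMart R c₀ I r u (n + 1) ω - eigenMart R c₀ I r u n ω) ^ 2 ∂μ :=
    Summable.of_nonneg_of_le (fun n => integral_nonneg fun ω => sq_nonneg _)
      (fun n => h.integral_sq_le (hK n)) ((summable_varWeight ha h.r_nonneg har).mul_left _)
  exact ⟨_, Filtration.stronglyMeasurable_limit_process'.measurable,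
    tendstoAEAndL2_limitProcess h.martingale h.memLp_eigenMart hs, hs⟩

theorem tendsto_dotProduct_div_rpow (hr : 0 < r) {g : Ω → ℝ}
    (hg : TendstoAEAndL2 μ (eigenMart R c₀ I r u) g) :
    TendstoAEAndL2 μ (fun n ω => (count R c₀ I n ω ⬝ᵥ u) / (n : ℝ) ^ r)
      (fun ω => growthConst r * g ω) := by
  have h1 := hg.mul_const_seq (tendsto_growth_div_rpow hr.le)
  have e : (fun n ω => growth r n / (n : ℝ) ^ r * eigenMart R c₀ I r u n ω)
      = fun n ω => (count R c₀ I n ω ⬝ᵥ u) / (n : ℝ) ^ r := by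
    ext n ω
    have := (growth_pos hr.le n).ne'
    rw [eigenMart, div_mul_div_comm, mul_comm ((n : ℝ) ^ r), mul_div_mul_left _ _ this]
  rwa [e] at h1

theorem Nondegenerate.const_mul {g : Ω → ℝ} (hg : Nondegenerate μ g) {c : ℝ} (hc : c ≠ 0) :
    Nondegenerate μ fun ω => c * g ω := by
  intro d hd
  refine hg (c⁻¹ * d) ?_
  filter_upwards [hd] with ω hω
  rw [← hω, inv_mul_cancel_left₀ hc]

end Draws

/-! ### The two regimes with a normal mixture limit -/

section Regimes

/-- If `ℓ` is the order of the variance weights and is small enough, the statistic along the second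
eigenvector is negligible with respect to the first one. -/
theorem tendsto_growth_ratio {a b c : ℝ} (ha : 0 ≤ a) {L S : ℕ → ℝ}
    (hL : ∀ᶠ n in atTop, L n ≠ 0)
    (h : Tendsto (fun n : ℕ => growth b n ^ 2 * S n / L n) atTop (𝓝 c))
    (hLa : Tendsto (fun n : ℕ => L n / ((n : ℝ) ^ a) ^ 2) atTop (𝓝 0)) :
    Tendsto (fun n : ℕ => growth b n ^ 2 * S n / growth a n ^ 2) atTop (𝓝 0) := by
  have h1 := (h.mul hLa).div ((tendsto_growth_div_rpow ha).pow 2)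
    (pow_pos (growthConst_pos ha) 2).ne'
  rw [mul_zero, zero_div] at h1
  refine h1.congr' ?_
  filter_upwards [hL, eventually_gt_atTop 0] with n hn hn0
  have h2 : (0 : ℝ) < (n : ℝ) ^ a := Real.rpow_pos_of_pos (Nat.cast_pos.2 hn0) _
  have h3 := (growth_pos ha n).ne'
  simp only [Pi.div_apply]
  field_simp

/-- Nonzero exponents make both sides vanish at `n = 0`, so the identity can be rewritten for every
`n`. -/
theorem rpow_sq_mul_rpow_sub {a b : ℝ} (ha : a ≠ 0) (hb : b ≠ 0) (n : ℕ) :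
    ((n : ℝ) ^ b) ^ 2 * (n : ℝ) ^ (a - 2 * b) = (n : ℝ) ^ a := by
  rcases n.eq_zero_or_pos with rfl | hn
  · simp [Real.zero_rpow ha, Real.zero_rpow hb]
  · have hn' : (0 : ℝ) < n := Nat.cast_pos.2 hn
    rw [← Real.rpow_natCast, ← Real.rpow_mul hn'.le, ← Real.rpow_add hn']
    congr 1
    push_cast
    ring

/-- The second limit fixes the normalization of the central limit theorem. The third makes the
errors in the conditional variances negligible: it compares `n ^ a` with `n ^ (2a)`. -/
theorem regime_lt {a b : ℝ} (hb : 0 < b) (hab : b < a / 2) :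
    Tendsto (fun n => ∑ k ∈ Finset.range n, varWeight a b k) atTop atTop ∧
    Tendsto (fun n : ℕ => growth b n ^ 2 * (∑ k ∈ Finset.range n, varWeight a b k) / (n : ℝ) ^ a)
      atTop (𝓝 (growthConst a * (a - 2 * b)⁻¹)) ∧
    Tendsto (fun n : ℕ => growth b n ^ 2 * (∑ k ∈ Finset.range n, varWeight a b k) /
      growth a n ^ 2) atTop (𝓝 0) := by
  have ha : 0 < a := by linarith
  have hρ : 0 < a - 2 * b := by linarith
  obtain ⟨h1, h2⟩ := tendsto_growth_sq_mul_sum hb.le (by linarith : 2 * b ≤ a)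
    (tendsto_sum_growth_atTop hρ) (tendsto_sum_growth_div_rpow hρ)
  simp_rw [rpow_sq_mul_rpow_sub ha.ne' hb.ne'] at h2
  have h0 : Tendsto (fun n : ℕ => (n : ℝ) ^ a) atTop atTop :=
    (tendsto_rpow_atTop ha).comp tendsto_natCast_atTop_atTop
  refine ⟨h1, h2, tendsto_growth_ratio ha.le (h0.eventually_ne_atTop 0) h2 ?_⟩
  refine h0.inv_tendsto_atTop.congr' ?_
  filter_upwards [h0.eventually_gt_atTop 0] with n hn
  simp only [Pi.inv_apply]
  field_simp

/-- At `a = 2b` the comparison weights are `1 / (k + 1)`, whence the logarithm; the third limit uses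
`log n = o(n ^ a)`. -/
theorem regime_eq {a b : ℝ} (hb : 0 < b) (hab : b = a / 2) :
    Tendsto (fun n => ∑ k ∈ Finset.range n, varWeight a b k) atTop atTop ∧
    Tendsto (fun n : ℕ => growth b n ^ 2 * (∑ k ∈ Finset.range n, varWeight a b k) /
      ((n : ℝ) ^ a * Real.log n)) atTop (𝓝 (growthConst a * 1)) ∧
    Tendsto (fun n : ℕ => growth b n ^ 2 * (∑ k ∈ Finset.range n, varWeight a b k) /
      growth a n ^ 2) atTop (𝓝 0) := by
  have ha : 0 < a := by linarith
  have hρ : a - 2 * b = 0 := by linarith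
  obtain ⟨h1, h2⟩ := tendsto_growth_sq_mul_sum (a := a) (b := b) (c := 1)
    (ℓ := fun n : ℕ => Real.log n) hb.le (by linarith : 2 * b ≤ a)
    (by rw [hρ]; exact tendsto_sum_growth_zero_atTop)
    (by rw [hρ]; exact tendsto_sum_growth_zero_div_log)
  have e : ∀ n : ℕ, ((n : ℝ) ^ b) ^ 2 = (n : ℝ) ^ a := fun n => by
    rw [← rpow_sq_mul_rpow_sub ha.ne' hb.ne', hρ, Real.rpow_zero, mul_one]
  simp_rw [e] at h2
  have h0 : Tendsto (fun n : ℕ => (n : ℝ) ^ a) atTop atTop :=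
    (tendsto_rpow_atTop ha).comp tendsto_natCast_atTop_atTop
  refine ⟨h1, h2, tendsto_growth_ratio ha.le ?_ h2 ?_⟩
  · filter_upwards [h0.eventually_ne_atTop 0, tendsto_log_natCast.eventually_ne_atTop 0]
      with n h3 h4 using mul_ne_zero h3 h4
  · have h3 := ((isLittleO_log_rpow_atTop ha).tendsto_div_nhds_zero).comp
      tendsto_natCast_atTop_atTop
    refine h3.congr' ?_
    filter_upwards [h0.eventually_gt_atTop 0] with n hn
    simp only [Function.comp_apply]
    field_simp

end Regimes

/-! ### Two eigenvectors linked by a quadratic relation -/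

section TwoEigenvectors

variable {Ω ι : Type*} [mΩ : MeasurableSpace Ω] {μ : Measure Ω} [IsProbabilityMeasure μ]
  [Fintype ι] [DecidableEq ι] [MeasurableSpace ι] [DiscreteMeasurableSpace ι]
  {R : Matrix ι ι ℝ} {c₀ : ι → ℝ} {I : ℕ → Ω → ι}
  {a b p q U W : ℝ} {u w : ι → ℝ}

theorem sq_integral_abs_le {Y : Ω → ℝ} (hY : MemLp Y 2 μ) :
    (∫ ω, |Y ω| ∂μ) ^ 2 ≤ ∫ ω, Y ω ^ 2 ∂μ := by
  have h := variance_nonneg |Y| μ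
  rw [variance_eq_sub hY.abs] at h
  simp only [Pi.pow_apply, Pi.abs_apply, sq_abs] at h
  linarith

/-- The relation `w² = p u - q w` makes the mean of `w²` linear in two eigenvector statistics, whose
means are explicit. -/
theorem EigenUrn.integral_sq_eq (hN : EigenUrn μ R c₀ I b w W) (hM : EigenUrn μ R c₀ I a u U)
    (hw : w ^ 2 = p • u - q • w) (n : ℕ) :
    ∫ ω, count R c₀ I n ω ⬝ᵥ (w ^ 2) ∂μ
      = p * ((c₀ ⬝ᵥ u) * growth a n) - q * ((c₀ ⬝ᵥ w) * growth b n) := by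
  simp_rw [hw, dotProduct_sub, dotProduct_smul, smul_eq_mul]
  rw [integral_sub ((hM.integrable_dotProduct u n).const_mul p)
    ((hN.integrable_dotProduct w n).const_mul q), integral_const_mul, integral_const_mul,
    hM.integral_dotProduct, hN.integral_dotProduct]

theorem EigenUrn.integral_sq_le_growth (hN : EigenUrn μ R c₀ I b w W)
    (hM : EigenUrn μ R c₀ I a u U) (hw : w ^ 2 = p • u - q • w) (hba : b ≤ a) (n : ℕ) :
    ∫ ω, count R c₀ I n ω ⬝ᵥ (w ^ 2) ∂μ
      ≤ (p * (c₀ ⬝ᵥ u) + |q * (c₀ ⬝ᵥ w)|) * growth a n := by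
  rw [hN.integral_sq_eq hM hw]
  have h1 := growth_le_growth hN.r_nonneg hba n
  have h2 := growth_pos hN.r_nonneg n
  have h3 : -(q * (c₀ ⬝ᵥ w)) * growth b n ≤ |q * (c₀ ⬝ᵥ w)| * growth a n :=
    mul_le_mul (neg_le_abs _) h1 h2.le (abs_nonneg _)
  linarith

/-- The negligible part of the conditional variance of the increments along `w`. -/
noncomputable def condVarError (R : Matrix ι ι ℝ) (c₀ : ι → ℝ) (I : ℕ → Ω → ι) (b q : ℝ)
    (w : ι → ℝ) (n : ℕ) (ω : Ω) : ℝ :=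
  -((b / growth b (n + 1)) ^ 2 * (q * ((count R c₀ I n ω ⬝ᵥ w) / ((n : ℝ) + 1))
    + ((count R c₀ I n ω ⬝ᵥ w) / ((n : ℝ) + 1)) ^ 2))

/-- Because `|y| / (n + 1) ≤ W`, the quadratic part is also linear in `|y|`. The factor `growth a n`
inside `varWeight` is divided out again, so any `a ≥ 0` will do; integrability uses `a = 0`. -/
theorem EigenUrn.abs_condVarError_le (hN : EigenUrn μ R c₀ I b w W) (hq : 0 ≤ q) (ha : 0 ≤ a)
    (n : ℕ) (ω : Ω) :
    |condVarError R c₀ I b q w n ω|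
      ≤ b ^ 2 * (q + W) * varWeight a b n / growth a n * |count R c₀ I n ω ⬝ᵥ w| := by
  have hga := growth_pos ha n
  have hgb := growth_pos hN.r_nonneg (n + 1)
  have hn : (0 : ℝ) < (n : ℝ) + 1 := by positivity
  have h1 := hN.abs_div_le n ω
  set y := (count R c₀ I n ω ⬝ᵥ w) with hy
  have h2 : |q * (y / ((n : ℝ) + 1)) + (y / ((n : ℝ) + 1)) ^ 2|
      ≤ (q + W) * (|y| / ((n : ℝ) + 1)) := by
    have e : q * (y / ((n : ℝ) + 1)) + (y / ((n : ℝ) + 1)) ^ 2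
        = (q + y / ((n : ℝ) + 1)) * (y / ((n : ℝ) + 1)) := by ring
    rw [e, abs_mul, abs_div y, abs_of_pos hn]
    gcongr
    refine (abs_add_le _ _).trans ?_
    rw [abs_of_nonneg hq]
    gcongr
  rw [condVarError, abs_neg, abs_mul, abs_of_nonneg (sq_nonneg _), varWeight, ← hy]
  calc _ ≤ (b / growth b (n + 1)) ^ 2 * ((q + W) * (|y| / ((n : ℝ) + 1))) := by gcongr
    _ = _ := by field_simp

theorem EigenUrn.integrable_condVarError (hN : EigenUrn μ R c₀ I b w W) (hq : 0 ≤ q) (n : ℕ) :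
    Integrable (condVarError R c₀ I b q w n) μ := by
  have hm := (measurable_count_dotProduct R c₀ I w n).mono
    (history_le hN.draw.measurable_draw n) le_rfl
  refine Integrable.mono' (((hN.integrable_dotProduct w n).abs).const_mul
    (b ^ 2 * (q + W) * varWeight 0 b n / growth 0 n)) ?_
    (ae_of_all _ (hN.abs_condVarError_le hq le_rfl n))
  exact (((((hm.div_const _).const_mul _).add ((hm.div_const _).pow_const 2)).const_mul _).neg).aestronglyMeasurable

/-- Pythagoras for the martingale along `w`, each increment contributing at most a multiple of its
weight; the `1` accounts for the initial value. -/
theorem EigenUrn.integral_sq_dotProduct_le (hN : EigenUrn μ R c₀ I b w W)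
    (hM : EigenUrn μ R c₀ I a u U) (hw : w ^ 2 = p • u - q • w) (hba : b ≤ a) :
    ∃ K : ℝ, 0 ≤ K ∧ ∀ n, ∫ ω, (count R c₀ I n ω ⬝ᵥ w) ^ 2 ∂μ
      ≤ K * (growth b n ^ 2 * (1 + ∑ k ∈ Finset.range n, varWeight a b k)) := by
  set K₁ := b ^ 2 * (p * (c₀ ⬝ᵥ u) + |q * (c₀ ⬝ᵥ w)|)
  refine ⟨2 * (c₀ ⬝ᵥ w) ^ 2 + 2 * |K₁|, by positivity, fun n => ?_⟩
  have hS : 0 ≤ ∑ k ∈ Finset.range n, varWeight a b k :=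
    Finset.sum_nonneg fun k _ => (varWeight_pos hM.r_nonneg hN.r_nonneg k).le
  have hg := growth_pos hN.r_nonneg n
  have h1 := integral_sq_martingale_sub hN.martingale hN.memLp_eigenMart 0 n
  simp only [zero_add] at h1
  have h2 : ∫ ω, (eigenMart R c₀ I b w n ω - eigenMart R c₀ I b w 0 ω) ^ 2 ∂μ
      ≤ |K₁| * ∑ k ∈ Finset.range n, varWeight a b k := by
    rw [h1, Finset.mul_sum]
    refine Finset.sum_le_sum fun k _ => ?_
    refine (hN.integral_sq_le (hN.integral_sq_le_growth hM hw hba k)).trans ?_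
    gcongr
    · exact (varWeight_pos hM.r_nonneg hN.r_nonneg k).le
    · exact le_abs_self _
  have hd : Integrable (fun ω => (eigenMart R c₀ I b w n ω - eigenMart R c₀ I b w 0 ω) ^ 2) μ :=
    ((hN.memLp_eigenMart n).sub (hN.memLp_eigenMart 0)).integrable_sq
  have hpt : ∀ ω, (count R c₀ I n ω ⬝ᵥ w) ^ 2 ≤ growth b n ^ 2 * (2 * (c₀ ⬝ᵥ w) ^ 2
      + 2 * (eigenMart R c₀ I b w n ω - eigenMart R c₀ I b w 0 ω) ^ 2) := by
    intro ω
    have e1 : count R c₀ I n ω ⬝ᵥ w = growth b n * eigenMart R c₀ I b w n ω := by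
      rw [eigenMart, mul_div_cancel₀ _ hg.ne']
    have e2 : eigenMart R c₀ I b w 0 ω = c₀ ⬝ᵥ w := by
      rw [eigenMart, growth_zero_right, div_one, count]
    rw [e1, e2, mul_pow]
    gcongr
    -- In `x² ≤ 2c² + 2(x - c)²` the difference of the two sides is `(x - 2c)²`.
    nlinarith [sq_nonneg (eigenMart R c₀ I b w n ω - 2 * (c₀ ⬝ᵥ w))]
  calc ∫ ω, (count R c₀ I n ω ⬝ᵥ w) ^ 2 ∂μ
      ≤ ∫ ω, growth b n ^ 2 * (2 * (c₀ ⬝ᵥ w) ^ 2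
        + 2 * (eigenMart R c₀ I b w n ω - eigenMart R c₀ I b w 0 ω) ^ 2) ∂μ :=
        integral_mono_of_nonneg (ae_of_all _ fun ω => sq_nonneg _)
          (((integrable_const _).add (hd.const_mul 2)).const_mul _) (ae_of_all _ hpt)
    _ = growth b n ^ 2 * (2 * (c₀ ⬝ᵥ w) ^ 2 + 2 * ∫ ω,
        (eigenMart R c₀ I b w n ω - eigenMart R c₀ I b w 0 ω) ^ 2 ∂μ) := by
        rw [integral_const_mul, integral_add (integrable_const _) (hd.const_mul 2)]
        simp [integral_const_mul]
    _ ≤ growth b n ^ 2 * (2 * (c₀ ⬝ᵥ w) ^ 2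
        + 2 * (|K₁| * ∑ k ∈ Finset.range n, varWeight a b k)) := by gcongr
    _ ≤ growth b n ^ 2 * ((2 * (c₀ ⬝ᵥ w) ^ 2 + 2 * |K₁|) *
        (1 + ∑ k ∈ Finset.range n, varWeight a b k)) := by
        gcongr
        have := mul_nonneg (sq_nonneg (c₀ ⬝ᵥ w)) hS
        nlinarith [abs_nonneg K₁]
    _ = _ := by ring

/-- By Stolz–Cesàro it suffices to compare single terms. The ratio of the mean error to its weight
is at most a constant times the mean of `|C_n w|` over `growth a n`, and Cauchy–Schwarz with the
preceding second moment bound reduces this to the root of a null sequence. -/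
theorem EigenUrn.tendsto_err (hN : EigenUrn μ R c₀ I b w W)
    (hM : EigenUrn μ R c₀ I a u U) (hw : w ^ 2 = p • u - q • w) (hba : b ≤ a) (hb : 0 < b)
    (hp : 0 < p) (hq : 0 ≤ q)
    (hS : Tendsto (fun n => ∑ k ∈ Finset.range n, varWeight a b k) atTop atTop)
    (hr : Tendsto (fun n : ℕ => growth b n ^ 2 * (∑ k ∈ Finset.range n, varWeight a b k) /
      growth a n ^ 2) atTop (𝓝 0)) :
    Tendsto (fun n => (∑ k ∈ Finset.range n, ∫ ω, |condVarError R c₀ I b q w k ω| ∂μ) /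
      ∑ k ∈ Finset.range n, p * b ^ 2 * varWeight a b k) atTop (𝓝 0) := by
  have hpb : 0 < p * b ^ 2 := by positivity
  have hv : ∀ n, 0 < varWeight a b n := varWeight_pos hM.r_nonneg hN.r_nonneg
  have hW : 0 ≤ W := by
    obtain ⟨ω₀⟩ := nonempty_of_isProbabilityMeasure μ
    exact (abs_nonneg _).trans (hN.abs_div_le 0 ω₀)
  refine tendsto_sum_div_sum (fun n => mul_pos hpb (hv n)) ?_ ?_
  · simp_rw [← Finset.mul_sum]
    exact hS.const_mul_atTop hpb
  obtain ⟨K, hK0, hK⟩ := hN.integral_sq_dotProduct_le hM hw hba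
  have hlim : Tendsto (fun n : ℕ => growth b n ^ 2 *
      (1 + ∑ k ∈ Finset.range n, varWeight a b k) / growth a n ^ 2) atTop (𝓝 0) := by
    have h1 : Tendsto (fun n => 1 / (∑ k ∈ Finset.range n, varWeight a b k) + 1) atTop
        (𝓝 (0 + 1)) := (tendsto_const_nhds.div_atTop hS).add_const 1
    have h2 := hr.mul h1
    rw [zero_mul] at h2
    refine h2.congr' ?_
    filter_upwards [hS.eventually_gt_atTop 0] with n hn
    field_simp
  have hlim2 : Tendsto (fun n : ℕ => (q + W) / p * √(K * (growth b n ^ 2 *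
      (1 + ∑ k ∈ Finset.range n, varWeight a b k) / growth a n ^ 2))) atTop (𝓝 0) := by
    have := ((hlim.const_mul K).sqrt).const_mul ((q + W) / p)
    simpa using this
  refine squeeze_zero (fun n => div_nonneg (integral_nonneg fun ω => abs_nonneg _)
    (mul_pos hpb (hv n)).le) (fun n => ?_) hlim2
  have hga := growth_pos hM.r_nonneg n
  have hY : MemLp (fun ω => count R c₀ I n ω ⬝ᵥ w) 2 μ := by
    have := (hN.memLp_eigenMart n).mul_const (growth b n)
    refine this.congr_norm ?_ ?_
    · exact (hN.integrable_dotProduct w n).1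
    · refine ae_of_all _ fun ω => ?_
      rw [eigenMart, div_mul_cancel₀ _ (growth_pos hN.r_nonneg n).ne']
  have h1 : ∫ ω, |count R c₀ I n ω ⬝ᵥ w| ∂μ ≤ √(K * (growth b n ^ 2 *
      (1 + ∑ k ∈ Finset.range n, varWeight a b k))) :=
    Real.le_sqrt_of_sq_le ((sq_integral_abs_le hY).trans (hK n))
  have h2 : ∫ ω, |condVarError R c₀ I b q w n ω| ∂μ
      ≤ b ^ 2 * (q + W) * varWeight a b n / growth a n * ∫ ω, |count R c₀ I n ω ⬝ᵥ w| ∂μ := by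
    rw [← integral_const_mul]
    exact integral_mono (hN.integrable_condVarError hq n).abs
      ((hN.integrable_dotProduct w n).abs.const_mul _)
      (hN.abs_condVarError_le hq hM.r_nonneg n)
  rw [div_le_iff₀ (mul_pos hpb (hv n))]
  have hvn := (hv n).le
  calc _ ≤ b ^ 2 * (q + W) * varWeight a b n / growth a n * √(K * (growth b n ^ 2 *
      (1 + ∑ k ∈ Finset.range n, varWeight a b k))) := h2.trans (by gcongr)
    _ = _ := by
      rw [← mul_div_assoc K, Real.sqrt_div' _ (sq_nonneg _), Real.sqrt_sq hga.le]
      field_simp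

/-- The urn satisfies the hypotheses of the martingale central limit theorem with mixing. -/
theorem EigenUrn.mixtureData (hN : EigenUrn μ R c₀ I b w W)
    (hM : EigenUrn μ R c₀ I a u U) (hw : w ^ 2 = p • u - q • w) (hba : b ≤ a) (hb : 0 < b)
    (hp : 0 < p) (hq : 0 ≤ q) (hu : ∀ i, 0 ≤ u i)
    (hS : Tendsto (fun n => ∑ k ∈ Finset.range n, varWeight a b k) atTop atTop)
    (hr : Tendsto (fun n : ℕ => growth b n ^ 2 * (∑ k ∈ Finset.range n, varWeight a b k) /
      growth a n ^ 2) atTop (𝓝 0))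
    (hsum : Summable fun n =>
        ∫ ω, (eigenMart R c₀ I a u (n + 1) ω - eigenMart R c₀ I a u n ω) ^ 2 ∂μ) :
    MixtureData μ (drawFiltration hN.draw.measurable_draw) (eigenMart R c₀ I a u)
      (eigenMart R c₀ I b w) (fun n => p * b ^ 2 * varWeight a b n) (condVarError R c₀ I b q w)
      (max (max (a * (2 * U)) (b * (2 * W))) (p * b ^ 2 * U)) where
  martM := hM.martingale
  martN := hN.martingale
  nonneg n ω := div_nonneg (Finset.sum_nonneg fun i _ => mul_nonneg
    (count_nonneg hM.R_nonneg hM.c_nonneg n ω i) (hu i)) (growth_pos hM.r_nonneg n).le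
  v_nonneg n := mul_nonneg (by positivity) (varWeight_pos hM.r_nonneg hN.r_nonneg n).le
  boundM n ω := (hM.abs_eigenMart_succ_sub_le n ω).trans
    ((le_max_left _ _).trans (le_max_left _ _))
  boundN n ω := (hN.abs_eigenMart_succ_sub_le n ω).trans
    ((le_max_right _ _).trans (le_max_left _ _))
  boundv n ω := by
    refine le_trans ?_ (le_max_right _ _)
    have hga := growth_pos hM.r_nonneg n
    have hgb := one_le_growth hN.r_nonneg (n + 1)
    have hn : (0 : ℝ) < (n : ℝ) + 1 := by positivity
    have h1 := (le_abs_self _).trans (hM.abs_div_le n ω)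
    have h0 : 0 ≤ U := (abs_nonneg _).trans (hM.abs_div_le n ω)
    -- The two factors `growth a n` cancel, leaving the bounded ratio `C_n u / (n + 1)`.
    have e : p * b ^ 2 * varWeight a b n * eigenMart R c₀ I a u n ω
        = p * b ^ 2 * (((count R c₀ I n ω ⬝ᵥ u) / ((n : ℝ) + 1)) / growth b (n + 1) ^ 2) := by
      rw [varWeight, eigenMart]
      field_simp
    rw [e]
    gcongr
    rw [div_le_iff₀ (by positivity)]
    nlinarith [one_le_pow₀ hgb (n := 2)]
  integrable_err := hN.integrable_condVarError hq
  condVar n := by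
    refine (hN.condExp_sq n).trans (ae_of_all _ fun ω => ?_)
    beta_reduce
    have hga := growth_pos hM.r_nonneg n
    have hgb := growth_pos hN.r_nonneg (n + 1)
    have hn : (0 : ℝ) < (n : ℝ) + 1 := by positivity
    -- Substituting `w² = p u - q w` isolates the term in `u` as the main part.
    rw [hw, dotProduct_sub, dotProduct_smul, dotProduct_smul, smul_eq_mul, smul_eq_mul,
      condVarError, varWeight, eigenMart]
    field_simp
    ring
  tendsto_sum := by
    simp_rw [← Finset.mul_sum]
    exact hS.const_mul_atTop (by positivity)
  tendsto_err := hN.tendsto_err hM hw hba hb hp hq hS hr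
  summable := hsum

/-- Passes from the normalization by the accumulated variance to the explicit `√(L n)`: the squared
ratio of the two tends to `p b² c`. -/
theorem EigenUrn.tendstoNormalMixture (hN : EigenUrn μ R c₀ I b w W)
    (hM : EigenUrn μ R c₀ I a u U) (hw : w ^ 2 = p • u - q • w) (hba : b ≤ a) (hb : 0 < b)
    (hp : 0 < p) (hq : 0 ≤ q) (hu : ∀ i, 0 ≤ u i) {L : ℕ → ℝ} {c : ℝ} (hc : 0 ≤ c)
    (hL0 : L 0 = 0)
    (hS : Tendsto (fun n => ∑ k ∈ Finset.range n, varWeight a b k) atTop atTop)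
    (hL : Tendsto (fun n : ℕ => growth b n ^ 2 * (∑ k ∈ Finset.range n, varWeight a b k) / L n)
      atTop (𝓝 c))
    (hr : Tendsto (fun n : ℕ => growth b n ^ 2 * (∑ k ∈ Finset.range n, varWeight a b k) /
      growth a n ^ 2) atTop (𝓝 0))
    (hsum : Summable fun n =>
        ∫ ω, (eigenMart R c₀ I a u (n + 1) ω - eigenMart R c₀ I a u n ω) ^ 2 ∂μ)
    {g : Ω → ℝ} (hg : Measurable g) (hg0 : ∀ᵐ ω ∂μ, 0 ≤ g ω)
    (hlim : ∀ᵐ ω ∂μ, Tendsto (fun n => eigenMart R c₀ I a u n ω) atTop (𝓝 (g ω))) :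
    TendstoNormalMixture μ (fun n ω => (count R c₀ I n ω ⬝ᵥ w) / √(L n))
      (fun ω => p * b ^ 2 * c * g ω) := by
  have h1 := (hN.mixtureData hM hw hba hb hp hq hu hS hr hsum).tendstoNormalMixture hg hg0 hlim
  have hlim2 : Tendsto (fun n : ℕ => √(p * b ^ 2 * (growth b n ^ 2 *
      (∑ k ∈ Finset.range n, varWeight a b k) / L n))) atTop (𝓝 √(p * b ^ 2 * c)) :=
    (hL.const_mul (p * b ^ 2)).sqrt
  have h2 := h1.mul_const_seq hlim2 (Real.sqrt_nonneg _)
  rw [Real.sq_sqrt (by positivity)] at h2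
  convert h2 using 3 with n ω
  rw [← Finset.mul_sum]
  have hgb := growth_pos hN.r_nonneg n
  rcases n.eq_zero_or_pos with rfl | hn
  -- At `n = 0` both sides are zero, by division by `√0` on one side and by the empty sum on the
  -- other.
  · simp [hL0]
  · have hSn : 0 < ∑ k ∈ Finset.range n, varWeight a b k :=
      Finset.sum_pos (fun k _ => varWeight_pos hM.r_nonneg hN.r_nonneg k)
        (Finset.nonempty_range_iff.2 hn.ne')
    have hS' : 0 < √(p * b ^ 2 * ∑ k ∈ Finset.range n, varWeight a b k) :=
      Real.sqrt_pos.2 (by positivity)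
    have e : p * b ^ 2 * (growth b n ^ 2 * (∑ k ∈ Finset.range n, varWeight a b k) / L n)
        = growth b n ^ 2 * (p * b ^ 2 * ∑ k ∈ Finset.range n, varWeight a b k) / L n := by ring
    rw [e, Real.sqrt_div (by positivity), Real.sqrt_mul (sq_nonneg _), Real.sqrt_sq hgb.le,
      eigenMart]
    field_simp

end TwoEigenvectors

end Urn

/-! ### The three-colour urn -/

theorem mainTheorem3 {Ω : Type*} [MeasurableSpace Ω] (μ : Measure Ω) [IsProbabilityMeasure μ]
    (r11 r12 r13 r22 r23 : ℝ) (hr13 : 0 ≤ r13) (hr23 : 0 ≤ r23)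
    (hrow1 : r11 + r12 + r13 = 1) (hrow2 : r22 + r23 = 1)
    (h22 : 0 < r22) (h2211 : r22 < r11) (h12 : 0 < r12)
    (c₀ : Fin 3 → ℝ) (hc₀ : ∀ i, 0 < c₀ i) (hc₀sum : ∑ i, c₀ i = 1)
    (R : Matrix (Fin 3) (Fin 3) ℝ)
    (hR : R = !![r11, r12, r13; 0, r22, r23; 0, 0, 1])
    (I : ℕ → Ω → Fin 3) (hI : Urn.IsDrawSequence μ R c₀ I)
    (C : ℕ → Ω → Fin 3 → ℝ) (hC : C = Urn.count R c₀ I)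
    (ξ₂ : Fin 3 → ℝ) (hξ₂ : ξ₂ = ![r12, r22 - r11, 0]) :
    ∃ V₁ : Ω → ℝ, Measurable V₁ ∧ (∀ᵐ ω ∂μ, 0 ≤ V₁ ω) ∧ Urn.Nondegenerate μ V₁ ∧
      Urn.TendstoAEAndL2 μ (fun n ω => C n ω 0 / (n : ℝ) ^ r11) V₁ ∧
      (r22 < r11 / 2 →
        Urn.TendstoNormalMixture μ (fun n ω => (C n ω ⬝ᵥ ξ₂) / √((n : ℝ) ^ r11))
          (fun ω => r12 * r22 ^ 2 * (r12 + r11 - r22) / (r11 - 2 * r22) * V₁ ω)) ∧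
      (r22 = r11 / 2 →
        Urn.TendstoNormalMixture μ
          (fun n ω => (C n ω ⬝ᵥ ξ₂) / √((n : ℝ) ^ r11 * Real.log n))
          (fun ω => r12 * r22 ^ 2 * (r12 + r11 - r22) * V₁ ω)) ∧
      (r11 / 2 < r22 →
        ∃ W : Ω → ℝ, Measurable W ∧ Urn.Nondegenerate μ W ∧
          Urn.TendstoAEAndL2 μ (fun n ω => (C n ω ⬝ᵥ ξ₂) / (n : ℝ) ^ r22) W) := by
  have h11 : 0 < r11 := h22.trans h2211
  have hR0 : ∀ i j, 0 ≤ R i j := by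
    intro i j
    rw [hR]
    fin_cases i <;> fin_cases j <;> simp <;> linarith
  have hRs : ∀ i, ∑ j, R i j = 1 := by
    intro i
    rw [hR]
    fin_cases i <;> simp [Fin.sum_univ_three] <;> linarith
  have hM : Urn.EigenUrn μ R c₀ I r11 ![1, 0, 0] 1 :=
    { draw := hI, R_nonneg := hR0, R_sum := hRs, c_nonneg := fun i => (hc₀ i).le, c_sum := hc₀sum
      eigen := by
        rw [hR]
        ext i
        fin_cases i <;> simp [Matrix.mulVec, dotProduct, Fin.sum_univ_three]
      r_nonneg := h11.le
      bound := fun i => by fin_cases i <;> simp }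
  have hN : Urn.EigenUrn μ R c₀ I r22 ξ₂ (r12 + (r11 - r22)) :=
    { draw := hI, R_nonneg := hR0, R_sum := hRs, c_nonneg := fun i => (hc₀ i).le, c_sum := hc₀sum
      eigen := by
        rw [hR, hξ₂]
        ext i
        fin_cases i
        · simp [Matrix.mulVec, dotProduct, Fin.sum_univ_three]
          ring
        · simp [Matrix.mulVec, dotProduct, Fin.sum_univ_three]
        · simp [Matrix.mulVec, dotProduct, Fin.sum_univ_three]
      r_nonneg := h22.le
      bound := fun i => by
        rw [hξ₂]
        fin_cases i
        · simp only [Fin.zero_eta, Matrix.cons_val_zero]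
          rw [abs_of_pos h12]
          linarith
        · change |r22 - r11| ≤ _
          rw [abs_of_neg (by linarith)]
          linarith
        · simp
          linarith }
  -- The second coordinate forces `q = r11 - r22`, and the first then gives `p = r12 (r12 + q)`.
  have hw : ξ₂ ^ 2 = (r12 * (r12 + r11 - r22)) • ![1, 0, 0] - (r11 - r22) • ξ₂ := by
    rw [hξ₂]
    ext i
    fin_cases i
    · simp
      ring
    · simp
      ring
    · simp
  have hp : 0 < r12 * (r12 + r11 - r22) := mul_pos h12 (by linarith)
  have hq : 0 ≤ r11 - r22 := by linarith
  have hu : ∀ i, (0 : ℝ) ≤ (![1, 0, 0] : Fin 3 → ℝ) i := fun i => by fin_cases i <;> simp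
  have hu2 : (![1, 0, 0] : Fin 3 → ℝ) ^ 2 = ![1, 0, 0] := by
    ext i
    fin_cases i <;> simp
  -- As `e² = e`, the mean of `C_n e²` is exactly a multiple of `growth r11 n`, so the criterion
  -- reads `r11 < 2 r11`.
  obtain ⟨g, hgm, hg, hsum⟩ := hM.tendsto_limit h11.le (by linarith : r11 < 2 * r11)
    (fun n => by rw [hu2]; exact (hM.integral_dotProduct n).le)
  have hγ := Urn.growthConst_pos h11.le
  have hg0 : ∀ᵐ ω ∂μ, 0 ≤ g ω := by
    filter_upwards [hg.1] with ω hω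
    refine ge_of_tendsto' hω fun n => div_nonneg (Finset.sum_nonneg fun i _ => mul_nonneg
      (Urn.count_nonneg hM.R_nonneg hM.c_nonneg n ω i) (hu i)) (Urn.growth_pos h11.le n).le
  have hC0 : ∀ n ω, C n ω 0 = Urn.count R c₀ I n ω ⬝ᵥ ![1, 0, 0] := fun n ω => by
    rw [hC]
    simp [dotProduct, Fin.sum_univ_three]
  refine ⟨fun ω => Urn.growthConst r11 * g ω, hgm.const_mul _, ?_, ?_, ?_, ?_, ?_, ?_⟩
  · filter_upwards [hg0] with ω hω using mul_nonneg hγ.le hω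
  · exact (hM.nondegenerate h11 (hc₀ 0) (hc₀ 1) (by simp) hg).const_mul hγ.ne'
  · simp_rw [hC0]
    exact Urn.tendsto_dotProduct_div_rpow h11 hg
  · intro hlt
    obtain ⟨hS, hL, hr⟩ := Urn.regime_lt h22 hlt
    have hρ : 0 < r11 - 2 * r22 := by linarith
    have h := hN.tendstoNormalMixture hM hw h2211.le h22 hp hq hu (by positivity)
      (by simp [Real.zero_rpow h11.ne']) hS hL hr hsum hgm hg0 hg.1
    rw [hC]
    convert h using 2 with ω
    field_simp
  · intro heq
    obtain ⟨hS, hL, hr⟩ := Urn.regime_eq h22 heq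
    have h := hN.tendstoNormalMixture hM hw h2211.le h22 hp hq hu (by positivity)
      (by simp) hS hL hr hsum hgm hg0 hg.1
    rw [hC]
    convert h using 2 with ω
    ring
  · intro hgt
    -- The mean of `C_n ξ₂²` grows at most like `growth r11 n`, so the criterion is now `r11 < 2
    -- r22`.
    obtain ⟨f, hfm, hf, -⟩ := hN.tendsto_limit h11.le (by linarith : r11 < 2 * r22)
      (hN.integral_sq_le_growth hM hw h2211.le)
    refine ⟨fun ω => Urn.growthConst r22 * f ω, hfm.const_mul _, ?_, ?_⟩
    · refine (hN.nondegenerate h22 (hc₀ 0) (hc₀ 1) ?_ hf).const_mul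
        (Urn.growthConst_pos h22.le).ne'
      -- The first two entries of `ξ₂` differ because `r12 > 0 > r22 - r11`.
      rw [hξ₂]
      simp
      linarith
    · rw [hC]
      exact Urn.tendsto_dotProduct_div_rpow h22 hf
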